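/- For integers $k\ge 1$ write $f_k=(q^k;q^k)_\infty=\prod_{n\ge1}(1-q^{kn})$. In each part, $a_n$ denotes the coefficient of $q^n$ in the power series expansion of the stated quotient. (1) Let $p\ge3$ be a prime, let $\frac{f_2^2}{f_1f_p}=\sum_{n\ge0}a_nq^n$, and let $$N=\max\left(\bigcup_{s=0}^{p-1}\min\left\{\tfrac{r(r+1)}2:\ \tfrac{r(r+1)}2\equiv s\pmod p,\ 0\le r\le p-1\right\}\right)-p,$$ where residues $s$ for which the set is empty are omitted. Then for all integers $n\ge 0$ with $n>N$: $a_n>0$ if $n\equiv\frac{r(r+1)}2\pmod p$ for some $0\le r\le p-1$, and $a_n=0$ otherwise. (2) Let $p=1$ or let $p$ be an odd prime, let $\frac{f_1^2}{f_2f_{4p}}=\sum_{n\ge0}a_nq^n$, and let $$N=\max\left(\bigcup_{s=0}^{4p-1}\min\left\{r^2:\ r^2\equiv s\pmod{4p},\ 0\le r\le 4p-1\right\}\right)-4p,$$ where residues $s$ for which the set is empty are omitted. Then for all integers $n\ge0$ with $n>N$: $a_n<0$ if $n\equiv4t^2+4t+1\pmod{4p}$ for some $0\le t\le p-1$; $a_n>0$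 if $n\equiv4t^2\pmod{4p}$ for some $0\le t\le p-1$; and $a_n=0$ otherwise, i.e. if $n\equiv2,3\pmod4$ or $\left(\frac np\right)=-1$. Here $\left(\frac np\right)$ is the Legendre symbol, and $\left(\frac n1\right)=1$. (3) If $\frac{f_1^3}{f_3^2}=\sum_{n\ge0} a_nq^n$, then for all $n\ge0$: $a_n>0$ if $n\equiv0\pmod3$, $a_n<0$ if $n\equiv1\pmod3$, and $a_n=0$ otherwise. (4) If $\frac{f_1^2}{f_2f_3^2}=\sum_{n\ge0} a_nq^n$, then for all $n\ge0$: $a_n>0$ if $n\equiv0\pmod3$, $a_n<0$ if $n\equiv1\pmod3$, and $a_n=0$ otherwise. (5) If $\frac{f_1^4}{f_2^2f_4}=\sum_{n\ge0} a_nq^n$, then for all $n\ge0$: $a_n>0$ if $n\equiv0,2\pmod4$, $a_n<0$ if $n\equiv1\pmod4$, and $a_n=0$ otherwise. (6) If $\frac{f_2^{10}}{f_1^4f_4^5}=\sum_{n\ge0} a_nq^n$, then for all $n\ge0$: $a_n>0$ if $n\equiv0,1,2\pmod4$, and $a_n=0$ otherwise. (7) If $\frac{f_1^2}{f_5^3}=\sum_{n\ge0}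 a_nq^n$, then for all $n\ge0$: $a_n>0$ if $n\equiv0,3,4\pmod5$, and $a_n<0$ otherwise. (8) If $\frac{f_1^9}{f_3^9}=\sum_{n\ge0} a_nq^n$, then for all $n\ge0$: $a_n>0$ if $n\equiv0,2,5,8\pmod9$, $a_n<0$ if $n\equiv1,3,4,7\pmod9$, and $a_n=0$ otherwise. (9) Let $i\ge11$ be an integer and $\frac{f_1^9}{f_3^i}=\sum_{n\ge0} a_nq^n$. Then for all $n\ge0$: (a) when $i=11$: $a_n>0$ if $n\equiv0,2,5,8\pmod9$, and $a_n<0$ otherwise; (b) when $i=12$: $a_n>0$ if $n\equiv0,2,5,8\pmod9$, $a_n<0$ if $n\equiv1,4,7\pmod9$, and $a_n=0$ otherwise; (c) when $i>12$: $a_n>0$ if $n\equiv0,2\pmod3$, and $a_n<0$ otherwise. -/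

import Mathlib

section EtaQuotients

open scoped PowerSeries.WithPiTopology

/-- The infinite product `(q^k; q^k)_∞ = ∏_{n ≥ 1} (1 - q^{k n})`, as a formal power series in
`q = X` with rational coefficients (the product converges coefficientwise for `k ≥ 1`). -/
noncomputable def qProd (k : ℕ) : PowerSeries ℚ :=
  ∏' n : ℕ, (1 - PowerSeries.X ^ (k * (n + 1)))

/-- The product defining `(q^k; q^k)_∞` converges. -/
theorem multipliable_qProd {k : ℕ} (hk : 0 < k) :
    Multipliable fun n : ℕ => (1 : PowerSeries ℚ) - PowerSeries.X ^ (k * (n + 1)) := by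
  simp_rw [sub_eq_add_neg]
  apply PowerSeries.WithPiTopology.multipliable_one_add_of_tendsto_order_atTop_nhds_top
  refine ENat.tendsto_nhds_top_iff_natCast_lt.mpr (fun n => Filter.eventually_atTop.mpr ⟨n, ?_⟩)
  intro m hm
  rw [PowerSeries.order_neg, PowerSeries.order_X_pow]
  norm_cast
  nlinarith

/-- `(q^k; q^k)_∞` has constant coefficient `1`, so it can be inverted as a power series. -/
theorem constantCoeff_qProd {k : ℕ} (hk : 0 < k) :
    PowerSeries.constantCoeff (qProd k) = 1 := by
  have h := (multipliable_qProd hk).map_tprod (PowerSeries.constantCoeff (R := ℚ))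
    (PowerSeries.WithPiTopology.continuous_constantCoeff ℚ)
  rw [qProd, h]
  have : ∀ n : ℕ, k * (n + 1) ≠ 0 := fun n => by positivity
  simp [this]

end EtaQuotients

/-- The set of all numbers `min {g r : g r ≡ s (mod m), 0 ≤ r ≤ m - 1}`, one for each residue
`s = 0, …, m - 1` for which the set under the minimum is not empty. -/
def leastValues (g : ℕ → ℕ) (m : ℕ) : Set ℕ :=
  {v | ∃ s < m, IsLeast {w | ∃ r < m, g r ≡ s [MOD m] ∧ w = g r} v}

/-- The bound
`max (⋃_{s=0}^{m-1} min {g r : g r ≡ s (mod m), 0 ≤ r ≤ m - 1}) - m`, an integer which may be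
negative. -/
noncomputable def signBound (g : ℕ → ℕ) (m : ℕ) : ℤ :=
  ((sSup (leastValues g m) : ℕ) : ℤ) - (m : ℤ)

/-- The supremum in `signBound` is a maximum. -/
theorem isGreatest_leastValues (g : ℕ → ℕ) {m : ℕ} (hm : 0 < m) :
    IsGreatest (leastValues g m) (sSup (leastValues g m)) := by
  have hne : (leastValues g m).Nonempty := by
    have h : {w | ∃ r < m, g r ≡ g 0 % m [MOD m] ∧ w = g r}.Nonempty :=
      ⟨g 0, 0, hm, (Nat.mod_modEq _ _).symm, rfl⟩
    exact ⟨_, g 0 % m, Nat.mod_lt _ hm, Nat.sInf_mem h, fun _ hw => Nat.sInf_le hw⟩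
  have hfin : (leastValues g m).Finite := by
    refine ((Finset.range m).image g).finite_toSet.subset ?_
    rintro v ⟨s, -, ⟨r, hr, -, rfl⟩, -⟩
    simpa using ⟨r, hr, rfl⟩
  exact ⟨Nat.sSup_mem hne hfin.bddAbove, fun _ hv => le_csSup hfin.bddAbove hv⟩

/-! Each quotient is a numerator divided by a power of `f_m`, for some `m` among `p`, `4p`, `3`,
`4`, `5`. Since `1 / f_m` is a series in `X ^ m`, it does not mix residue classes modulo `m`. So the
numerator is split as `∑ X ^ j A_j(X ^ m)`, and the coefficients in the class of `j` are those of
`A_j` times a power of the partition series `1 / f₁`. The theorem then says that each `A_j` is zero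
or a constant times a series that becomes positive after this multiplication.

For `f₂² / (f₁ f_p)` and `f₁² / (f₂ f_{4p})` the numerators `f₂² / f₁` and `f₁² / f₂` are theta
series over triangular numbers and over squares, by the Jacobi triple product. Their signs are
constant on each residue class, so `a n` is nonzero exactly when some exponent of the theta series
is at most `n` and congruent to `n`; the bound `N` guarantees this for every class that occurs at
all. The quotients over `f₄` use squares of theta series, with representatives `0 = 0 + 0`, `1 = 1 +
0`, `2 = 1 + 1`, and the fact that no sum of two squares is `3` modulo `4`.

For `f₁³` Jacobi's series splits as `P(X³) - 3 X f₉³`, where `P = 6 D + f₁` and `D = ∑ (-1)^r r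
X^{r(3r+1)/2}` (`cube_dissection`). `D` is a derivative of the triple product, hence a product times
a Lambert series, and this form shows that `D / f₁²` is nonnegative
(`exists_pentagonal_derivative`). The other component requires positivity of `f₃³ / f₁²`
(`posCoeff_qProd_three_cube_mul`). Cubing gives `f₁⁹`, with components `-9 P² f₃³` and `27 P f₃⁶` in
the classes `1` and `2`. The class-`0` component `P³ - 27 X f₃⁹` is the norm of `f₁³` over series in
`X³`, and equals `f₁¹² / f₃³` (`cubicNorm_qProd_one`). Hence that class of `f₁⁹ / f₃^i` is
`f₁^(12-i) / f₃³`, which is dissected again when `i < 12`.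

For `f₁² / f₅³` the components `A`, `f₅`, `B` of `f₁ = A(X⁵) - X f₂₅ - X² B(X⁵)` satisfy `A B = f₅²`
(`fiveZero_mul_fiveTwo`), so every component of `f₁²` is a constant times a product of two of them;
`A / f₁`, `B / f₁` and `f₅ / f₁` are all nonnegative.

The triple product is obtained as a limit of a finite identity with Gaussian binomials over an
arbitrary commutative ring. Taking that ring to be the dual numbers yields the derivative
identities. -/

section EtaSigns

open PowerSeries Filter Topology
open scoped PowerSeries.WithPiTopology

/-! ### Convergence of infinite products -/

theorem multipliable_of_X_pow_dvd {f : ℕ → ℚ⟦X⟧} (h : ∀ n, X ^ n ∣ f n - 1) :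
    Multipliable f := by
  have h2 : f = fun n => 1 + (f n - 1) := by ext1 n; ring
  rw [h2]
  apply PowerSeries.WithPiTopology.multipliable_one_add_of_tendsto_order_atTop_nhds_top
  refine ENat.tendsto_nhds_top_iff_natCast_lt.mpr fun n => eventually_atTop.mpr ⟨n + 1, ?_⟩
  intro m hm
  have := X_pow_dvd_iff.mp (h m)
  refine lt_of_lt_of_le ?_ (nat_le_order _ m this)
  exact_mod_cast hm

theorem tendsto_coeff {F : ℕ → ℚ⟦X⟧} {G : ℚ⟦X⟧} (h : Tendsto F atTop (𝓝 G)) (d : ℕ) :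
    Tendsto (fun n => coeff d (F n)) atTop (𝓝 (coeff d G)) :=
  (PowerSeries.WithPiTopology.tendsto_iff_coeff_tendsto ℚ F atTop G).mp h d

theorem tendsto_tprod {f : ℕ → ℚ⟦X⟧} (h : Multipliable f) :
    Tendsto (fun n => ∏ i ∈ Finset.range n, f i) atTop (𝓝 (∏' i, f i)) :=
  h.hasProd.tendsto_prod_nat

theorem constantCoeff_tprod {f : ℕ → ℚ⟦X⟧} (h : Multipliable f)
    (h1 : ∀ n, constantCoeff (f n) = 1) : constantCoeff (∏' n, f n) = 1 := by
  rw [h.map_tprod constantCoeff (PowerSeries.WithPiTopology.continuous_constantCoeff ℚ)]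
  simp [h1]

/-! ### Series with nonnegative or positive coefficients -/

/-- All coefficients are nonnegative. -/
def NonnegCoeff (F : ℚ⟦X⟧) : Prop := ∀ n, 0 ≤ coeff n F

/-- All coefficients are positive. -/
def PosCoeff (F : ℚ⟦X⟧) : Prop := ∀ n, 0 < coeff n F

theorem PosCoeff.nonneg {F : ℚ⟦X⟧} (h : PosCoeff F) : NonnegCoeff F := fun n => (h n).le

theorem nonnegCoeff_one : NonnegCoeff 1 := fun n => by
  rw [coeff_one]; split_ifs <;> norm_num

theorem nonnegCoeff_X_pow (k : ℕ) : NonnegCoeff (X ^ k) := fun n => by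
  rw [coeff_X_pow]; split_ifs <;> norm_num

theorem NonnegCoeff.add {F G : ℚ⟦X⟧} (hF : NonnegCoeff F) (hG : NonnegCoeff G) :
    NonnegCoeff (F + G) := fun n => by
  rw [map_add]; exact add_nonneg (hF n) (hG n)

theorem NonnegCoeff.mul {F G : ℚ⟦X⟧} (hF : NonnegCoeff F) (hG : NonnegCoeff G) :
    NonnegCoeff (F * G) := fun n => by
  rw [coeff_mul]; exact Finset.sum_nonneg fun x _ => mul_nonneg (hF _) (hG _)

theorem NonnegCoeff.pow {F : ℚ⟦X⟧} (hF : NonnegCoeff F) (k : ℕ) : NonnegCoeff (F ^ k) := by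
  induction k with
  | zero => simpa using nonnegCoeff_one
  | succ k ih => rw [pow_succ]; exact ih.mul hF

theorem nonnegCoeff_prod {ι : Type*} (s : Finset ι) {f : ι → ℚ⟦X⟧}
    (h : ∀ i ∈ s, NonnegCoeff (f i)) : NonnegCoeff (∏ i ∈ s, f i) :=
  Finset.prod_induction f NonnegCoeff (fun _ _ => NonnegCoeff.mul) nonnegCoeff_one h

theorem nonnegCoeff_of_tendsto {F : ℕ → ℚ⟦X⟧} {G : ℚ⟦X⟧} (h : Tendsto F atTop (𝓝 G))
    (hF : ∀ n, NonnegCoeff (F n)) : NonnegCoeff G := fun d =>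
  ge_of_tendsto' (tendsto_coeff h d) fun n => hF n d

theorem nonnegCoeff_tprod {f : ℕ → ℚ⟦X⟧} (h : Multipliable f)
    (hf : ∀ n, NonnegCoeff (f n)) : NonnegCoeff (∏' n, f n) :=
  nonnegCoeff_of_tendsto (tendsto_tprod h) fun _ => nonnegCoeff_prod _ fun i _ => hf i

theorem PosCoeff.mul {F G : ℚ⟦X⟧} (hF : PosCoeff F) (hG : NonnegCoeff G)
    (hG0 : 0 < constantCoeff G) : PosCoeff (F * G) := fun n => by
  rw [coeff_mul]
  refine Finset.sum_pos' (fun x _ => mul_nonneg (hF.nonneg _) (hG _)) ⟨(n, 0), by simp, ?_⟩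
  exact mul_pos (hF n) (by simpa using hG0)

theorem PosCoeff.add {F G : ℚ⟦X⟧} (hF : PosCoeff F) (hG : NonnegCoeff G) :
    PosCoeff (F + G) := fun n => by
  rw [map_add]; exact add_pos_of_pos_of_nonneg (hF n) (hG n)

theorem PosCoeff.constantCoeff_pos {F : ℚ⟦X⟧} (hF : PosCoeff F) : 0 < constantCoeff F := by
  simpa using hF 0

theorem one_sub_X_pow_inv {n : ℕ} (hn : 0 < n) :
    (1 - X ^ n : ℚ⟦X⟧)⁻¹ = expand n hn.ne' (mk 1) := by
  rw [PowerSeries.inv_eq_iff_mul_eq_one (by simp [hn.ne'])]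
  have := congrArg (expand n hn.ne') (mk_one_mul_one_sub_eq_one ℚ)
  simpa using this

theorem one_sub_X_pow_mul_inv {n : ℕ} (hn : 0 < n) :
    (1 - X ^ n : ℚ⟦X⟧) * (1 - X ^ n)⁻¹ = 1 :=
  PowerSeries.mul_inv_cancel _ (by simp [hn.ne'])

theorem nonnegCoeff_one_sub_X_pow_inv {n : ℕ} (hn : 0 < n) :
    NonnegCoeff (1 - X ^ n : ℚ⟦X⟧)⁻¹ := fun d => by
  rw [one_sub_X_pow_inv hn, coeff_expand]; split_ifs <;> simp

theorem posCoeff_one_sub_X_inv : PosCoeff (1 - X : ℚ⟦X⟧)⁻¹ := fun d => by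
  have := one_sub_X_pow_inv one_pos
  rw [pow_one] at this
  rw [this]; simp

/-! ### Eta products with arbitrary exponents -/

/-- `∏_{n ≥ 1} (1 - X ^ n) ^ c n`. -/
noncomputable def eProd (c : ℕ → ℕ) : ℚ⟦X⟧ := ∏' n : ℕ, (1 - X ^ (n + 1)) ^ c (n + 1)

/-- `∏_{n ≥ 1} (1 - X ^ n) ^ (- c n)`. -/
noncomputable def eInv (c : ℕ → ℕ) : ℚ⟦X⟧ := ∏' n : ℕ, (1 - X ^ (n + 1))⁻¹ ^ c (n + 1)

theorem multipliable_eProd (c : ℕ → ℕ) :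
    Multipliable fun n : ℕ => (1 - X ^ (n + 1) : ℚ⟦X⟧) ^ c (n + 1) := by
  refine multipliable_of_X_pow_dvd fun n => ?_
  have h := sub_dvd_pow_sub_pow (1 - X ^ (n + 1) : ℚ⟦X⟧) 1 (c (n + 1))
  rw [one_pow] at h
  refine dvd_trans ?_ h
  exact ⟨-X, by ring⟩

theorem multipliable_eInv (c : ℕ → ℕ) :
    Multipliable fun n : ℕ => (1 - X ^ (n + 1) : ℚ⟦X⟧)⁻¹ ^ c (n + 1) := by
  refine multipliable_of_X_pow_dvd fun n => ?_
  have h := sub_dvd_pow_sub_pow ((1 - X ^ (n + 1) : ℚ⟦X⟧)⁻¹) 1 (c (n + 1))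
  rw [one_pow] at h
  refine dvd_trans ?_ h
  refine ⟨X * (1 - X ^ (n + 1))⁻¹, ?_⟩
  linear_combination one_sub_X_pow_mul_inv (n := n + 1) (Nat.succ_pos n)

/-- Exponent functions encode eta products, so identities between products become pointwise
identities in `ℕ`, usually settled by case splits and `omega`. The value at `0` plays no role. -/
theorem eProd_congr {c d : ℕ → ℕ} (h : ∀ n, 0 < n → c n = d n) : eProd c = eProd d :=
  tprod_congr fun n => by rw [h _ n.succ_pos]

theorem eInv_congr {c d : ℕ → ℕ} (h : ∀ n, 0 < n → c n = d n) : eInv c = eInv d :=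
  tprod_congr fun n => by rw [h _ n.succ_pos]

theorem eProd_add (c d : ℕ → ℕ) : eProd (fun n => c n + d n) = eProd c * eProd d := by
  rw [eProd, eProd, eProd, ← (multipliable_eProd c).tprod_mul (multipliable_eProd d)]
  simp_rw [pow_add]

theorem eInv_add (c d : ℕ → ℕ) : eInv (fun n => c n + d n) = eInv c * eInv d := by
  rw [eInv, eInv, eInv, ← (multipliable_eInv c).tprod_mul (multipliable_eInv d)]
  simp_rw [pow_add]

theorem eProd_mul_eInv_self (c : ℕ → ℕ) : eProd c * eInv c = 1 := by
  rw [eProd, eInv, ← (multipliable_eProd c).tprod_mul (multipliable_eInv c)]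
  simp_rw [← mul_pow, one_sub_X_pow_mul_inv (Nat.succ_pos _), one_pow, tprod_one]

theorem constantCoeff_eProd (c : ℕ → ℕ) : constantCoeff (eProd c) = 1 :=
  constantCoeff_tprod (multipliable_eProd c) fun n => by simp

theorem constantCoeff_eInv (c : ℕ → ℕ) : constantCoeff (eInv c) = 1 :=
  constantCoeff_tprod (multipliable_eInv c) fun n => by simp

theorem eProd_inv (c : ℕ → ℕ) : (eProd c)⁻¹ = eInv c := by
  rw [PowerSeries.inv_eq_iff_mul_eq_one (by simp [constantCoeff_eProd]), mul_comm,
    eProd_mul_eInv_self]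

theorem eProd_mul_eInv {c d c' : ℕ → ℕ} (h : ∀ n, 0 < n → c n + d n = c' n) :
    eProd c * eInv c' = eInv d := by
  rw [← eInv_congr h, eInv_add, ← mul_assoc, eProd_mul_eInv_self, one_mul]

theorem nonnegCoeff_eInv (c : ℕ → ℕ) : NonnegCoeff (eInv c) :=
  nonnegCoeff_tprod (multipliable_eInv c) fun n =>
    (nonnegCoeff_one_sub_X_pow_inv n.succ_pos).pow _

theorem eProd_single (m : ℕ) (hm : 0 < m) : eProd (fun n => if n = m then 1 else 0) = 1 - X ^ m := by
  rw [eProd, tprod_eq_mulSingle (m - 1)]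
  · simp [Nat.sub_add_cancel hm]
  · intro n hn
    rw [if_neg (by omega), pow_zero]

theorem eInv_single (m : ℕ) (hm : 0 < m) :
    eInv (fun n => if n = m then 1 else 0) = (1 - X ^ m)⁻¹ := by
  rw [← eProd_inv, eProd_single m hm]

/-- One factor `(1 - X)⁻¹`, all of whose coefficients are `1`, is split off; the remaining product
is nonnegative with constant term `1`. -/
theorem posCoeff_eInv {c : ℕ → ℕ} (h : 1 ≤ c 1) : PosCoeff (eInv c) := by
  have : eInv c = eInv (fun n => if n = 1 then 1 else 0)
      * eInv (fun n => if n = 1 then c n - 1 else c n) := by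
    rw [← eInv_add]
    refine eInv_congr fun n _ => ?_
    split_ifs with h1
    · subst h1; omega
    · omega
  rw [this, eInv_single 1 one_pos, pow_one]
  exact posCoeff_one_sub_X_inv.mul (nonnegCoeff_eInv _) (by simp [constantCoeff_eInv])

/-! ### Products over arithmetic progressions -/

/-- `∏_{n ≥ 0} (1 + s X ^ (i + k n))`. -/
noncomputable def apProd (s : ℚ) (i k : ℕ) : ℚ⟦X⟧ := ∏' n : ℕ, (1 + C s * X ^ (i + k * n))

theorem multipliable_apProd (s : ℚ) (i : ℕ) {k : ℕ} (hk : 0 < k) :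
    Multipliable fun n : ℕ => (1 + C s * X ^ (i + k * n) : ℚ⟦X⟧) := by
  refine multipliable_of_X_pow_dvd fun n => ?_
  rw [add_sub_cancel_left]
  exact dvd_mul_of_dvd_right (pow_dvd_pow _ (by nlinarith)) _

/-- The bounds `0 < i ≤ k` make `i` the least positive member of its class, so the progression `i +
k n` exhausts the positive integers congruent to `i`. -/
theorem apProd_neg_one_eq_eProd {i k : ℕ} (hi : 0 < i) (hik : i ≤ k) :
    apProd (-1) i k = eProd (fun n => if n % k = i % k then 1 else 0) := by
  have hk : 0 < k := by omega
  have hinj : Function.Injective fun n : ℕ => i + k * n - 1 := by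
    intro a b hab
    have : i + k * a = i + k * b := by
      have h1 : i + k * a - 1 = i + k * b - 1 := hab
      omega
    exact Nat.eq_of_mul_eq_mul_left hk (by omega)
  rw [apProd, eProd]
  have key := hinj.tprod_eq (f := fun n : ℕ =>
    (1 - X ^ (n + 1) : ℚ⟦X⟧) ^ (if (n + 1) % k = i % k then 1 else 0)) ?_
  · rw [← key]
    refine tprod_congr fun n => ?_
    have h1 : i + k * n - 1 + 1 = i + k * n := by omega
    simp only [h1, Nat.add_mul_mod_self_left, if_true, map_neg, map_one]
    ring
  · intro n hn
    by_cases h : (n + 1) % k = i % k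
    · have h2 : i ≤ n + 1 := by
        rcases hik.lt_or_eq with h3 | h3
        · rw [Nat.mod_eq_of_lt h3] at h
          exact h ▸ Nat.mod_le _ _
        · rw [h3, Nat.mod_self] at h
          exact h3 ▸ Nat.le_of_dvd n.succ_pos (Nat.dvd_of_mod_eq_zero h)
      obtain ⟨t, ht⟩ := (Nat.modEq_iff_dvd' h2).mp (show i ≡ n + 1 [MOD k] from h.symm)
      exact ⟨t, by simp only; omega⟩
    · simp [h] at hn

theorem qProd_eq_apProd (k : ℕ) : qProd k = apProd (-1) k k := by
  refine tprod_congr fun n => ?_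
  rw [map_neg, map_one, show k * (n + 1) = k + k * n by ring]
  ring

theorem qProd_eq_eProd {k : ℕ} (hk : 0 < k) :
    qProd k = eProd (fun n => if k ∣ n then 1 else 0) := by
  rw [qProd_eq_apProd, apProd_neg_one_eq_eProd hk le_rfl]
  refine eProd_congr fun n _ => ?_
  simp only [Nat.mod_self, Nat.dvd_iff_mod_eq_zero]

theorem apProd_one_mul_neg_one (i : ℕ) {k : ℕ} (hk : 0 < k) :
    apProd 1 i k * apProd (-1) i k = apProd (-1) (2 * i) (2 * k) := by
  rw [apProd, apProd, apProd,
    ← (multipliable_apProd 1 i hk).tprod_mul (multipliable_apProd (-1) i hk)]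
  refine tprod_congr fun n => ?_
  rw [map_neg, map_one, show 2 * i + 2 * k * n = (i + k * n) + (i + k * n) by ring, pow_add]
  ring

theorem apProd_eq_mul (s : ℚ) (i : ℕ) {k : ℕ} (hk : 0 < k) :
    apProd s i k = (1 + C s * X ^ i) * apProd s (i + k) k := by
  rw [apProd, tprod_eq_zero_mul']
  · simp only [mul_zero, add_zero, apProd]
    congr 1
    exact tprod_congr fun n => by rw [show i + k * (n + 1) = i + k + k * n by ring]
  · have := multipliable_apProd s (i + k) hk
    refine this.congr fun n => ?_
    rw [show i + k * (n + 1) = i + k + k * n by ring]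

/-! ### Dissections -/

theorem continuous_expand {p : ℕ} (hp : p ≠ 0) :
    Continuous (expand p hp : ℚ⟦X⟧ →ₐ[ℚ] ℚ⟦X⟧) := by
  rw [continuous_iff_continuousAt]
  intro F
  refine (PowerSeries.WithPiTopology.tendsto_iff_coeff_tendsto ℚ _ _ _).mpr fun d => ?_
  simp_rw [coeff_expand]
  split_ifs
  · exact (PowerSeries.WithPiTopology.continuous_coeff ℚ _).tendsto F
  · exact tendsto_const_nhds

theorem expand_qProd {p : ℕ} (hp : p ≠ 0) {k : ℕ} (hk : 0 < k) :
    expand p hp (qProd k) = qProd (p * k) := by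
  rw [qProd, (multipliable_qProd hk).map_tprod _ (continuous_expand hp), qProd]
  refine tprod_congr fun n => ?_
  simp [← pow_mul, mul_assoc]

theorem coeff_X_pow_mul_expand {m : ℕ} (hm : m ≠ 0) {j : ℕ} (hj : j < m) (F : ℚ⟦X⟧) (n : ℕ) :
    coeff n (X ^ j * expand m hm F) = if n % m = j then coeff (n / m) F else 0 := by
  rw [coeff_X_pow_mul', coeff_expand]
  have h1 := Nat.div_add_mod n m
  by_cases h : n % m = j
  · have h2 : n - j = m * (n / m) := by omega
    rw [if_pos (by omega), if_pos h, h2, if_pos (dvd_mul_right _ _),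
      Nat.mul_div_cancel_left _ (Nat.pos_of_ne_zero hm)]
  · rw [if_neg h]
    by_cases h3 : j ≤ n
    · rw [if_pos h3, if_neg]
      rintro ⟨t, ht⟩
      apply h
      rw [show n = j + m * t by omega, Nat.add_mul_mod_self_left, Nat.mod_eq_of_lt hj]
    · rw [if_neg h3]

/-- The coefficient of a series that is given by its `m`-dissection. -/
theorem coeff_dissection {m : ℕ} (hm : m ≠ 0) (A : ℕ → ℚ⟦X⟧) (n : ℕ) :
    coeff n (∑ j ∈ Finset.range m, X ^ j * expand m hm (A j)) = coeff (n / m) (A (n % m)) := by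
  rw [map_sum, Finset.sum_congr rfl fun j hj =>
    coeff_X_pow_mul_expand hm (Finset.mem_range.mp hj) (A j) n, Finset.sum_ite_eq, if_pos]
  exact Finset.mem_range.mpr (Nat.mod_lt _ (Nat.pos_of_ne_zero hm))

/-- A sum over `ℤ` may be computed along a system of residues modulo `m`. -/
theorem hasSum_int_residues {f : ℤ → ℚ⟦X⟧} {m : ℕ} (hm : 0 < m) {ρ : ℕ → ℤ}
    (hρ : ∀ j < m, ρ j % m = j) {A : ℕ → ℚ⟦X⟧}
    (h : ∀ j < m, HasSum (fun t : ℤ => f (m * t + ρ j)) (A j)) :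
    HasSum f (∑ j ∈ Finset.range m, A j) := by
  have hm' : (m : ℤ) ≠ 0 := by exact_mod_cast hm.ne'
  have hmod : ∀ r : ℤ, (r % m).toNat < m ∧ ((r % m).toNat : ℤ) = r % m := fun r => by
    have h1 := Int.emod_nonneg r hm'
    have h2 := Int.emod_lt_of_pos r (by exact_mod_cast hm : (0 : ℤ) < m)
    omega
  have hf : f = fun r : ℤ => ∑ j ∈ Finset.range m, if r % m = (j : ℤ) then f r else 0 := by
    ext1 r
    have h1 := hmod r
    rw [Finset.sum_eq_single (r % m).toNat]
    · rw [if_pos h1.2.symm]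
    · intro b _ hb
      rw [if_neg]
      omega
    · intro hn
      exact absurd (Finset.mem_range.mpr h1.1) hn
  rw [hf]
  refine hasSum_sum fun j hj => ?_
  have hj' := Finset.mem_range.mp hj
  have hinj : Function.Injective fun t : ℤ => (m : ℤ) * t + ρ j := by
    intro a b hab
    have : (m : ℤ) * a = m * b := by simpa using hab
    exact mul_left_cancel₀ hm' this
  rw [← hinj.hasSum_iff]
  · have := h j hj'
    refine this.congr_fun ?_
    intro t
    simp [hρ j hj']
  · intro r hr
    rw [if_neg]
    intro hrj
    apply hr
    have : (m : ℤ) ∣ r - ρ j := Int.ModEq.dvd (by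
      rw [Int.ModEq, hρ j hj', hrj])
    obtain ⟨t, ht⟩ := this
    exact ⟨t, by simp only; linarith⟩

/-! ### Triangular numbers -/

/-- The triangular number `r (r + 1) / 2` for an integer `r`. -/
def tri (r : ℤ) : ℕ := (r * (r + 1) / 2).toNat

theorem two_mul_tri (r : ℤ) : 2 * (tri r : ℤ) = r * (r + 1) := by
  have h1 : 0 ≤ r * (r + 1) := by
    rcases le_or_gt 0 r with h | h
    · positivity
    · nlinarith
  have h2 : (2 : ℤ) ∣ r * (r + 1) := (Int.even_mul_succ_self r).two_dvd
  rw [tri, Int.toNat_of_nonneg (by omega)]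
  omega

theorem tri_cast (r : ℤ) : (tri r : ℚ) = r * (r + 1) / 2 := by
  have : 2 * (tri r : ℚ) = r * (r + 1) := by exact_mod_cast two_mul_tri r
  linarith

theorem tri_succ (r : ℤ) : (tri (r + 1) : ℤ) = tri r + r + 1 := by
  have h1 := two_mul_tri r
  have h2 := two_mul_tri (r + 1)
  linarith

theorem natAbs_le_tri (r : ℤ) : r.natAbs ≤ tri r + 1 := by
  have h := two_mul_tri r
  zify
  rcases abs_cases r with ⟨h1, h2⟩ | ⟨h1, h2⟩ <;> rw [h1] <;> nlinarith

/-- The exponents `i r (r + 1) / 2 + j r (r - 1) / 2` of a theta series. -/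
def thetaExp (i j : ℕ) (r : ℤ) : ℕ := i * tri r + j * tri (r - 1)

theorem thetaExp_cast (i j : ℕ) (r : ℤ) :
    (thetaExp i j r : ℚ) = i * (r * (r + 1) / 2) + j * ((r - 1) * r / 2) := by
  rw [thetaExp]
  push_cast [tri_cast]
  ring

/-- Linear growth of the exponents: only finitely many `r` contribute to a given coefficient, and
the error terms in the limit of the finite triple product are controlled. -/
theorem natAbs_le_thetaExp {i j : ℕ} (h : 0 < i + j) (r : ℤ) :
    r.natAbs ≤ thetaExp i j r + 1 := by
  rw [thetaExp]
  -- One of the two triangular numbers suffices; for `i = 0` the symmetry `tri (-r) = tri (r - 1)`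
  -- reduces to the bound for `tri`.
  rcases Nat.eq_zero_or_pos i with hi | hi
  · have h1 := natAbs_le_tri (-r)
    have h2 : tri (-r) = tri (r - 1) := by
      have h3 := two_mul_tri (-r)
      have h4 := two_mul_tri (r - 1)
      zify
      linarith
    rw [Int.natAbs_neg, h2] at h1
    have : 0 < j := by omega
    nlinarith
  · have := natAbs_le_tri r
    nlinarith

/-! ### Gaussian binomial coefficients and the finite triple product -/

section Gauss

variable {S : Type*} [CommRing S]

/-- The Gaussian binomial coefficient with parameter `Q`. -/
def gauss (Q : S) : ℕ → ℕ → S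
  | _, 0 => 1
  | 0, _ + 1 => 0
  | n + 1, k + 1 => gauss Q n (k + 1) + Q ^ (n - k) * gauss Q n k

theorem gauss_zero_right (Q : S) (n : ℕ) : gauss Q n 0 = 1 := by
  cases n <;> rfl

theorem gauss_succ (Q : S) (n k : ℕ) :
    gauss Q (n + 1) (k + 1) = gauss Q n (k + 1) + Q ^ (n - k) * gauss Q n k := rfl

theorem gauss_eq_zero (Q : S) {n k : ℕ} (h : n < k) : gauss Q n k = 0 := by
  induction n generalizing k with
  | zero =>
    obtain ⟨k, rfl⟩ := Nat.exists_eq_succ_of_ne_zero h.ne'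
    rfl
  | succ n ih =>
    obtain ⟨k, rfl⟩ := Nat.exists_eq_succ_of_ne_zero (Nat.ne_zero_of_lt h)
    rw [Nat.succ_eq_add_one, gauss_succ, ih (by omega), ih (by omega), mul_zero, add_zero]

/-- The second Pascal rule, with the power of `Q` on the other summand. The triple product needs
both: this one when a factor in `b` is added, `gauss_succ` when a factor in `a` is added. -/
theorem gauss_succ' (Q : S) (n k : ℕ) :
    gauss Q (n + 1) (k + 1) = gauss Q n k + Q ^ (k + 1) * gauss Q n (k + 1) := by
  induction n generalizing k with
  | zero =>
    cases k with
    | zero => simp [gauss]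
    | succ k => simp [gauss]
  | succ n ih =>
    cases k with
    | zero =>
      have h1 := ih 0
      have h2 := gauss_succ Q n 0
      rw [gauss_succ Q (n + 1) 0]
      simp only [gauss_zero_right, Nat.sub_zero, zero_add, pow_one, mul_one] at *
      linear_combination h1 - Q * h2
    | succ k =>
      have h1 := ih (k + 1)
      have h2 := gauss_succ Q n (k + 1)
      have h3 := gauss_succ Q n k
      have h4 := ih k
      rw [gauss_succ Q (n + 1) (k + 1), Nat.add_sub_add_right]
      rcases Nat.lt_or_ge k n with h | h
      · obtain ⟨t, rfl⟩ := Nat.exists_eq_add_of_lt h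
        simp only [show k + t + 1 - k = t + 1 by omega, show k + t + 1 - (k + 1) = t by omega] at *
        linear_combination h1 - Q ^ (k + 2) * h2 - h3 + Q ^ (t + 1) * h4
      · rw [gauss_eq_zero Q (show n < k + 1 by omega)] at h1 h2 h3 h4
        linear_combination h1 - Q ^ (k + 2) * h2 - h3 + Q ^ (n - k) * h4

/-- The partial product `∏_{l=1}^{n} (1 - Q ^ l)`. -/
def qPoch (Q : S) (n : ℕ) : S := ∏ l ∈ Finset.range n, (1 - Q ^ (l + 1))

theorem qPoch_succ (Q : S) (n : ℕ) : qPoch Q (n + 1) = qPoch Q n * (1 - Q ^ (n + 1)) :=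
  Finset.prod_range_succ _ _

theorem gauss_mul_qPoch (Q : S) (u v : ℕ) :
    gauss Q (u + v) v * qPoch Q u * qPoch Q v = qPoch Q (u + v) := by
  induction v generalizing u with
  | zero => simp [gauss_zero_right, qPoch]
  | succ v ihv =>
    induction u with
    | zero =>
      have h := ihv 0
      simp only [zero_add] at h ⊢
      rw [gauss_succ, gauss_eq_zero Q (Nat.lt_succ_self v), qPoch_succ, Nat.sub_self]
      linear_combination (1 - Q ^ (v + 1)) * h
    | succ u ihu =>
      have h := ihv (u + 1)
      rw [show u + 1 + (v + 1) = (u + 1 + v) + 1 by ring, gauss_succ,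
        show u + 1 + v - v = u + 1 by omega, qPoch_succ Q (u + 1 + v)]
      rw [show u + (v + 1) = u + 1 + v by ring] at ihu
      rw [qPoch_succ Q u, qPoch_succ Q v] at *
      linear_combination (1 - Q ^ (u + 1)) * ihu + Q ^ (u + 1) * (1 - Q ^ (v + 1)) * h

theorem map_gauss {T : Type*} [CommRing T] (f : S →+* T) (Q : S) (n k : ℕ) :
    f (gauss Q n k) = gauss (f Q) n k := by
  induction n generalizing k with
  | zero => cases k <;> simp [gauss]
  | succ n ih =>
    cases k with
    | zero => simp [gauss]
    | succ k => simp [gauss_succ, ih]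

/-- The general term `a ^ (r (r + 1) / 2) b ^ (r (r - 1) / 2)` of a theta series. -/
def thetaTerm (a b : S) (r : ℤ) : S := a ^ tri r * b ^ tri (r - 1)

/-- The case without factors in `a`, which starts the induction of `finite_triple_product`.
Multiplication by the new factor shifts the theta terms, and `e1`, `e2` match the exponents of `a`
and `b`. -/
theorem prod_one_add_right (a b : S) (n : ℕ) :
    ∏ l ∈ Finset.range n, (1 + b * (a * b) ^ l) =
      ∑ k ∈ Finset.range (n + 1), gauss (a * b) n k * thetaTerm a b (k - n) := by
  induction n with
  | zero => simp [gauss, thetaTerm, tri]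
  | succ n ih =>
    rw [Finset.prod_range_succ, ih, mul_add, mul_one, Finset.sum_range_succ' _ (n + 1)]
    simp_rw [gauss_succ', add_mul]
    rw [Finset.sum_add_distrib, add_assoc]
    congr 1
    · refine Finset.sum_congr rfl fun k _ => ?_
      push_cast
      rw [add_sub_add_right_eq_sub]
    · have key : ∀ k ∈ Finset.range (n + 1),
          gauss (a * b) n k * thetaTerm a b (k - n) * (b * (a * b) ^ n) =
          (a * b) ^ k * gauss (a * b) n k * thetaTerm a b (k - (n + 1 : ℕ)) := by
        intro k hk
        have hk : k ≤ n := by simpa [Nat.lt_succ_iff] using hk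
        suffices h : thetaTerm a b (k - n) * (b * (a * b) ^ n) =
            (a * b) ^ k * thetaTerm a b (k - (n + 1 : ℕ)) by
          linear_combination gauss (a * b) n k * h
        have h1 := tri_succ (k - n - 1)
        have h2 := tri_succ (k - n - 1 - 1)
        rw [sub_add_cancel] at h1 h2
        rw [thetaTerm, thetaTerm, mul_pow, mul_pow,
          show (k : ℤ) - (n + 1 : ℕ) = k - n - 1 by push_cast; ring]
        have e1 : tri (k - n) + n = k + tri (k - n - 1) := by omega
        have e2 : tri (k - n - 1) + (n + 1) = k + tri (k - n - 1 - 1) := by omega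
        calc _ = a ^ (tri (k - n) + n) * b ^ (tri (k - n - 1) + (n + 1)) := by ring
          _ = _ := by rw [e1, e2]; ring
      rw [Finset.sum_mul, Finset.sum_congr rfl key, Finset.sum_range_succ' _ n,
        Finset.sum_range_succ _ n, gauss_eq_zero (a * b) (Nat.lt_succ_self n)]
      simp [gauss_zero_right]

/-- The finite form of the Jacobi triple product identity. -/
theorem finite_triple_product (a b : S) (m n : ℕ) :
    (∏ l ∈ Finset.range m, (1 + a * (a * b) ^ l)) * ∏ l ∈ Finset.range n, (1 + b * (a * b) ^ l) =
      ∑ k ∈ Finset.range (m + n + 1), gauss (a * b) (m + n) k * thetaTerm a b (k - n) := by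
  induction m with
  | zero => simpa using prod_one_add_right a b n
  | succ m ih =>
    rw [Finset.prod_range_succ, mul_right_comm, ih, mul_add, mul_one,
      show m + 1 + n = m + n + 1 by ring, Finset.sum_range_succ' _ (m + n + 1)]
    simp_rw [gauss_succ, add_mul]
    rw [Finset.sum_add_distrib, add_right_comm (Finset.sum _ _)]
    congr 1
    · rw [Finset.sum_range_succ' _ (m + n), Finset.sum_range_succ _ (m + n),
        gauss_eq_zero (a * b) (Nat.lt_succ_self (m + n))]
      simp [gauss_zero_right]
    · rw [Finset.sum_mul]
      refine Finset.sum_congr rfl fun k hk => ?_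
      have hk : k ≤ m + n := by simpa [Nat.lt_succ_iff] using hk
      suffices h : thetaTerm a b (k - n) * (a * (a * b) ^ m) =
          (a * b) ^ (m + n - k) * thetaTerm a b ((k + 1 : ℕ) - n) by
        linear_combination gauss (a * b) (m + n) k * h
      have h1 := tri_succ (k - n)
      have h2 := tri_succ (k - n - 1)
      rw [sub_add_cancel] at h2
      rw [thetaTerm, thetaTerm, mul_pow, mul_pow,
        show ((k + 1 : ℕ) : ℤ) - n = k - n + 1 by push_cast; ring, add_sub_cancel_right]
      have e1 : tri (k - n) + (m + 1) = (m + n - k) + tri (k - n + 1) := by omega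
      have e2 : tri (k - n - 1) + m = (m + n - k) + tri (k - n) := by omega
      calc _ = a ^ (tri (k - n) + (m + 1)) * b ^ (tri (k - n - 1) + m) := by ring
        _ = _ := by rw [e1, e2]; ring

end Gauss

/-! ### Passage to the limit -/

theorem X_pow_dvd_qPoch_sub {K : ℕ} (hK : 0 < K) (n t : ℕ) :
    (X : ℚ⟦X⟧) ^ (n + 1) ∣ qPoch (X ^ K) (n + t) - qPoch (X ^ K) n := by
  induction t with
  | zero => simp
  | succ t ih =>
    have : qPoch (X ^ K : ℚ⟦X⟧) (n + (t + 1)) - qPoch (X ^ K) n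
        = (qPoch (X ^ K) (n + t) - qPoch (X ^ K) n)
          - X ^ (K * (n + t + 1)) * qPoch (X ^ K) (n + t) := by
      rw [← add_assoc, qPoch_succ, ← pow_mul]; ring
    rw [this]
    exact dvd_sub ih (dvd_mul_of_dvd_left (pow_dvd_pow _ (by nlinarith)) _)

theorem tendsto_qPoch {K : ℕ} (hK : 0 < K) :
    Tendsto (fun n => qPoch (X ^ K : ℚ⟦X⟧) n) atTop (𝓝 (qProd K)) := by
  have := tendsto_tprod (multipliable_qProd hK)
  simp_rw [pow_mul] at this
  simpa only [qPoch, qProd, pow_mul] using this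

theorem X_pow_dvd_of_tendsto {F : ℕ → ℚ⟦X⟧} {G : ℚ⟦X⟧} (h : Tendsto F atTop (𝓝 G)) {N : ℕ}
    (hF : ∀ n, X ^ N ∣ F n) : X ^ N ∣ G := by
  rw [X_pow_dvd_iff]
  intro d hd
  have h1 := tendsto_coeff h d
  simp_rw [fun n => X_pow_dvd_iff.mp (hF n) d hd] at h1
  exact (tendsto_nhds_unique h1 tendsto_const_nhds)

theorem X_pow_dvd_qProd_sub {K : ℕ} (hK : 0 < K) (n : ℕ) :
    (X : ℚ⟦X⟧) ^ (n + 1) ∣ qProd K - qPoch (X ^ K) n := by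
  have h := ((tendsto_add_atTop_iff_nat n).mpr (tendsto_qPoch hK)).sub_const (qPoch (X ^ K) n)
  refine X_pow_dvd_of_tendsto h fun t => ?_
  rw [add_comm t n]
  exact X_pow_dvd_qPoch_sub hK n t

/-- Since `gauss` is a quotient of partial products, multiplying by the unit `qPoch (max u v)` turns
the difference into tails of the infinite product, which are divisible by `X ^ (min u v + 1)`. -/
theorem X_pow_dvd_qProd_mul_gauss {K : ℕ} (hK : 0 < K) (u v : ℕ) :
    (X : ℚ⟦X⟧) ^ (min u v + 1) ∣ qProd K * gauss (X ^ K) (u + v) v - 1 := by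
  have hunit : IsUnit (qPoch (X ^ K : ℚ⟦X⟧) (max u v)) := by
    rw [PowerSeries.isUnit_iff_constantCoeff, qPoch, map_prod]
    simp [hK.ne']
  have hg : gauss (X ^ K : ℚ⟦X⟧) (u + v) v * qPoch (X ^ K) (min u v) * qPoch (X ^ K) (max u v)
      = qPoch (X ^ K) (max u v + min u v) := by
    rw [max_add_min, ← gauss_mul_qPoch]
    rcases le_total u v with h | h <;> simp [h, mul_right_comm]
  rw [← hunit.dvd_mul_right]
  have e : (qProd K * gauss (X ^ K) (u + v) v - 1) * qPoch (X ^ K) (max u v)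
      = (qProd K - qPoch (X ^ K) (min u v)) * (gauss (X ^ K) (u + v) v * qPoch (X ^ K) (max u v))
        + (qPoch (X ^ K) (max u v + min u v) - qPoch (X ^ K) (max u v)) := by
    linear_combination hg
  rw [e]
  refine dvd_add (dvd_mul_of_dvd_left (X_pow_dvd_qProd_sub hK _) _) ?_
  exact dvd_trans (pow_dvd_pow _ (by omega)) (X_pow_dvd_qPoch_sub hK (max u v) (min u v))

/-- The weights `w` are arbitrary so that the same limit serves the triple product (`w r = s ^ r`)
and its derivative (`w r = (-1) ^ r * r`). -/
theorem tendsto_triple_product {i j : ℕ} (hij : 0 < i + j) (w : ℤ → ℚ) {P : ℕ → ℚ⟦X⟧}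
    (hP : ∀ m, P m = ∑ k ∈ Finset.range (m + m + 1),
      gauss (X ^ (i + j)) (m + m) k * monomial (thetaExp i j (k - m)) (w (k - m))) :
    ∃ D, HasSum (fun r : ℤ => monomial (thetaExp i j r) (w r)) D ∧
      Tendsto (fun m => qProd (i + j) * P m) atTop (𝓝 D) := by
  let D : ℚ⟦X⟧ := mk fun d => ∑ r ∈ Finset.Icc (-(d + 1 : ℤ)) (d + 1),
    coeff d (monomial (thetaExp i j r) (w r) : ℚ⟦X⟧)
  have hzero : ∀ (d : ℕ) (r : ℤ), r ∉ Finset.Icc (-(d + 1 : ℤ)) (d + 1) →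
      coeff d (monomial (thetaExp i j r) (w r) : ℚ⟦X⟧) = 0 := by
    intro d r hr
    rw [coeff_monomial, if_neg]
    intro hd
    have := natAbs_le_thetaExp hij r
    rw [Finset.mem_Icc] at hr
    omega
  refine ⟨D, ?_, ?_⟩
  · rw [PowerSeries.WithPiTopology.hasSum_iff_hasSum_coeff]
    intro d
    rw [coeff_mk]
    exact hasSum_sum_of_ne_finset_zero (hzero d)
  · refine (PowerSeries.WithPiTopology.tendsto_iff_coeff_tendsto ℚ _ _ _).mpr fun d => ?_
    refine tendsto_atTop_of_eventually_const (i₀ := d + 1) fun m hm => ?_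
    have h1 : (X : ℚ⟦X⟧) ^ m ∣ qProd (i + j) * P m - ∑ k ∈ Finset.range (m + m + 1),
        monomial (thetaExp i j (k - m)) (w (k - m)) := by
      rw [hP, Finset.mul_sum, ← Finset.sum_sub_distrib]
      refine Finset.dvd_sum fun k hk => ?_
      have hk : k ≤ m + m := by simpa [Nat.lt_succ_iff] using hk
      have h2 := X_pow_dvd_qProd_mul_gauss hij (m + m - k) k
      rw [Nat.sub_add_cancel hk] at h2
      have h3 : (X : ℚ⟦X⟧) ^ thetaExp i j (k - m) ∣
          monomial (thetaExp i j (k - m)) (w (k - m)) := by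
        rw [monomial_eq_C_mul_X_pow]
        exact dvd_mul_left _ _
      have h4 := mul_dvd_mul h2 h3
      rw [← pow_add] at h4
      have h5 := natAbs_le_thetaExp hij (k - m)
      have e : qProd (i + j) * (gauss (X ^ (i + j)) (m + m) k *
            monomial (thetaExp i j (k - m)) (w (k - m)))
          - monomial (thetaExp i j (k - m)) (w (k - m))
          = (qProd (i + j) * gauss (X ^ (i + j)) (m + m) k - 1)
            * monomial (thetaExp i j (k - m)) (w (k - m)) := by ring
      rw [e]
      -- Here `min (2m - k) k = m - |k - m|`, while the theta exponent is at least `|k - m| - 1`;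
      -- together with the `+ 1` these add up to at least `m`.
      exact dvd_trans (pow_dvd_pow _ (by omega)) h4
    have h2 := X_pow_dvd_iff.mp h1 d (by omega)
    rw [map_sub, sub_eq_zero] at h2
    rw [h2, map_sum, coeff_mk]
    have h3 : ∑ k ∈ Finset.range (m + m + 1),
        coeff d (monomial (thetaExp i j (k - m)) (w (k - m)) : ℚ⟦X⟧) =
        ∑ r ∈ Finset.Icc (-(m : ℤ)) m, coeff d (monomial (thetaExp i j r) (w r) : ℚ⟦X⟧) := by
      refine Finset.sum_bij (fun k _ => (k : ℤ) - m) ?_ ?_ ?_ ?_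
      · intro k hk
        rw [Finset.mem_range] at hk
        rw [Finset.mem_Icc]
        omega
      · intro a _ b _ hab
        simpa using hab
      · intro r hr
        rw [Finset.mem_Icc] at hr
        exact ⟨(r + m).toNat, by rw [Finset.mem_range]; omega, by omega⟩
      · intro k _
        rfl
    rw [h3]
    symm
    refine Finset.sum_subset ?_ fun r _ hr => hzero d r hr
    refine Finset.Icc_subset_Icc ?_ ?_ <;> omega

theorem signed_monomial_mul {s : ℚ} (hs : s ^ 2 = 1) (i j : ℕ) :
    (C s * X ^ i : ℚ⟦X⟧) * (C s * X ^ j) = X ^ (i + j) := by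
  rw [show (C s * X ^ i : ℚ⟦X⟧) * (C s * X ^ j) = C (s ^ 2) * X ^ (i + j) by
    rw [map_pow]; ring, hs, map_one, one_mul]

/-- The sign occurs `tri r + tri (r - 1) = r + 2 tri (r - 1)` times, which has the parity of `r`. -/
theorem thetaTerm_signed_monomial {s : ℚ} (hs : s ^ 2 = 1) (i j : ℕ) (r : ℤ) :
    thetaTerm (C s * X ^ i : ℚ⟦X⟧) (C s * X ^ j) r = monomial (thetaExp i j r) (s ^ r) := by
  have hs0 : s ≠ 0 := by rintro rfl; norm_num at hs
  have h1 : s ^ r = s ^ (tri r + tri (r - 1)) := by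
    have h2 := two_mul_tri r
    have h3 := two_mul_tri (r - 1)
    have h4 : ((tri r + tri (r - 1) : ℕ) : ℤ) = r + 2 * (tri (r - 1) : ℤ) := by
      push_cast; linarith
    rw [← zpow_natCast, h4, zpow_add₀ hs0, zpow_mul,
      show s ^ (2 : ℤ) = 1 by exact_mod_cast hs, one_zpow, mul_one]
  rw [thetaTerm, monomial_eq_C_mul_X_pow, h1, thetaExp, pow_add, map_mul, map_pow, map_pow,
    mul_pow, mul_pow, pow_add, ← pow_mul, ← pow_mul]
  ring

/-- The Jacobi triple product identity at signed monomials. -/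
theorem hasSum_triple_product {s : ℚ} (hs : s ^ 2 = 1) {i j : ℕ} (hij : 0 < i + j) :
    HasSum (fun r : ℤ => monomial (thetaExp i j r) (s ^ r))
      (qProd (i + j) * (apProd s i (i + j) * apProd s j (i + j))) := by
  obtain ⟨D, hD, hlim⟩ := tendsto_triple_product hij (fun r => s ^ r)
    (P := fun m => (∏ l ∈ Finset.range m, (1 + C s * X ^ (i + (i + j) * l)))
      * ∏ l ∈ Finset.range m, (1 + C s * X ^ (j + (i + j) * l))) fun m => by
    have := finite_triple_product (C s * X ^ i : ℚ⟦X⟧) (C s * X ^ j) m m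
    simp_rw [signed_monomial_mul hs, thetaTerm_signed_monomial hs, ← pow_mul, mul_assoc,
      ← pow_add] at this
    exact this
  have h2 := ((tendsto_tprod (multipliable_apProd s i hij)).mul
    (tendsto_tprod (multipliable_apProd s j hij))).const_mul (qProd (i + j))
  rwa [tendsto_nhds_unique hlim h2] at hD

/-! ### Derivatives of the triple product via dual numbers -/

/-- The dual number `u (1 + c ε)`. -/
noncomputable def dualMul (u c : ℚ⟦X⟧) : DualNumber ℚ⟦X⟧ :=
  TrivSqZeroExt.inl u + TrivSqZeroExt.inr (c * u)

theorem dualMul_mul (u c v d : ℚ⟦X⟧) :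
    dualMul u c * dualMul v d = dualMul (u * v) (c + d) := by
  ext
  · simp [dualMul]
  · rw [TrivSqZeroExt.snd_mul]
    simp only [dualMul, TrivSqZeroExt.fst_add, TrivSqZeroExt.snd_add, TrivSqZeroExt.fst_inl,
      TrivSqZeroExt.snd_inl, TrivSqZeroExt.fst_inr, TrivSqZeroExt.snd_inr, smul_eq_mul,
      MulOpposite.smul_eq_mul_unop, MulOpposite.unop_op]
    ring_nf

theorem dualMul_pow (u c : ℚ⟦X⟧) (n : ℕ) : dualMul u c ^ n = dualMul (u ^ n) (n * c) := by
  induction n with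
  | zero => ext <;> simp [dualMul]
  | succ n ih =>
    rw [pow_succ, ih, dualMul_mul, pow_succ]
    push_cast
    ring_nf

theorem fst_dualMul (u c : ℚ⟦X⟧) : (dualMul u c).fst = u := by simp [dualMul]

theorem snd_dualMul (u c : ℚ⟦X⟧) : (dualMul u c).snd = c * u := by simp [dualMul]

theorem dualMul_zero_right (u : ℚ⟦X⟧) : dualMul u 0 = TrivSqZeroExt.inl u := by simp [dualMul]

theorem dual_parameters_mul (i j : ℕ) :
    dualMul (C (-1) * X ^ i) 1 * dualMul (C (-1) * X ^ j) (-1)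
      = TrivSqZeroExt.inl (X ^ (i + j)) := by
  rw [dualMul_mul, signed_monomial_mul (by norm_num), add_neg_cancel, dualMul_zero_right]

/-- The `ε`-component of the finite triple product with `ε`-deformed parameters. -/
noncomputable def dualTriple (i j m : ℕ) : ℚ⟦X⟧ :=
  TrivSqZeroExt.snd ((∏ l ∈ Finset.range m, (1 + dualMul (C (-1) * X ^ (i + (i + j) * l)) 1))
    * ∏ l ∈ Finset.range m, (1 + dualMul (C (-1) * X ^ (j + (i + j) * l)) (-1)))

/-- The coefficients of the derivative of a signed theta series. -/
def signWeight (r : ℤ) : ℚ := (-1) ^ r * (r : ℚ)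

/-- The parameters are deformed by `1 + ε` and `1 - ε`. Their product is unchanged, hence so are the
Gaussian binomials, while the term of index `r` acquires the factor `1 + r ε` because `tri r - tri
(r - 1) = r`. -/
theorem dualTriple_eq (i j m : ℕ) :
    dualTriple i j m = ∑ k ∈ Finset.range (m + m + 1), gauss (X ^ (i + j)) (m + m) k *
        monomial (thetaExp i j (k - m)) (signWeight (k - m)) := by
  have h := finite_triple_product (dualMul (C (-1) * X ^ i) 1) (dualMul (C (-1) * X ^ j) (-1)) m m
  have hQ : ∀ (e : ℕ) (c : ℚ⟦X⟧) (l : ℕ), dualMul (C (-1) * X ^ e) c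
      * (TrivSqZeroExt.inl (X ^ (i + j))) ^ l = dualMul (C (-1) * X ^ (e + (i + j) * l)) c := by
    intro e c l
    rw [← dualMul_zero_right, dualMul_pow, dualMul_mul, ← pow_mul, mul_assoc, ← pow_add,
      mul_zero, add_zero]
  have hterm : ∀ r : ℤ, thetaTerm (dualMul (C (-1) * X ^ i) 1) (dualMul (C (-1) * X ^ j) (-1)) r
      = dualMul (monomial (thetaExp i j r) ((-1) ^ r)) (C (r : ℚ)) := by
    intro r
    rw [← thetaTerm_signed_monomial (by norm_num), thetaTerm, thetaTerm, dualMul_pow, dualMul_pow,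
      dualMul_mul]
    congr 1
    have h1 := tri_succ (r - 1)
    rw [sub_add_cancel] at h1
    have h2 : (r : ℚ) = (tri r : ℚ) - tri (r - 1) := by
      have : r = (tri r : ℤ) - tri (r - 1) := by linarith
      exact_mod_cast congrArg (Int.cast : ℤ → ℚ) this
    rw [h2, map_sub, map_natCast, map_natCast]
    ring
  have hg : ∀ n k : ℕ, gauss (TrivSqZeroExt.inl (X ^ (i + j)) : DualNumber ℚ⟦X⟧) n k
      = TrivSqZeroExt.inl (gauss (X ^ (i + j)) n k) := fun n k =>
    (map_gauss (TrivSqZeroExt.inlHom ℚ⟦X⟧ ℚ⟦X⟧) (X ^ (i + j)) n k).symm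
  simp_rw [dual_parameters_mul, hQ, hterm, hg] at h
  rw [dualTriple, h, TrivSqZeroExt.snd_sum]
  refine Finset.sum_congr rfl fun k _ => ?_
  rw [TrivSqZeroExt.snd_mul, TrivSqZeroExt.snd_inl, snd_dualMul]
  simp only [TrivSqZeroExt.fst_inl, smul_zero, add_zero, smul_eq_mul, monomial_eq_C_mul_X_pow,
    signWeight, map_mul]
  ring

theorem fst_prod_dual {ι : Type*} (s : Finset ι) (f : ι → DualNumber ℚ⟦X⟧) :
    (∏ l ∈ s, f l).fst = ∏ l ∈ s, (f l).fst :=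
  map_prod (TrivSqZeroExt.fstHom ℚ ℚ⟦X⟧ ℚ⟦X⟧) f s

theorem fst_one_add_dualMul (e : ℕ) (c : ℚ⟦X⟧) :
    (1 + dualMul (C (-1) * X ^ e) c).fst = 1 + C (-1) * X ^ e := by
  simp [fst_dualMul]

/-- For `j = 0` the initial factor of the second product is `1 - X ^ 0 (1 - ε) = ε`. Thus the
`ε`-component is the product of all other factors at `ε = 0`. -/
theorem dualTriple_one_zero (m : ℕ) :
    dualTriple 1 0 (m + 1) = (∏ l ∈ Finset.range (m + 1), (1 + C (-1) * X ^ (1 + 1 * l)))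
      * ∏ l ∈ Finset.range m, (1 + C (-1) * X ^ (1 + 1 * l)) := by
  rw [dualTriple, Finset.prod_range_succ' (fun l => 1 + dualMul (C (-1) * X ^ (0 + (1 + 0) * l)) (-1))]
  have h2 : (1 + dualMul (C (-1) * X ^ (0 + (1 + 0) * 0)) (-1) : DualNumber ℚ⟦X⟧)
      = TrivSqZeroExt.inr 1 := by
    ext1
    · simp [fst_dualMul]
    · simp [snd_dualMul]
  rw [h2, TrivSqZeroExt.snd_mul, TrivSqZeroExt.snd_mul]
  simp only [TrivSqZeroExt.fst_mul, TrivSqZeroExt.fst_inr, TrivSqZeroExt.snd_inr, fst_prod_dual,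
    fst_one_add_dualMul, mul_zero, smul_eq_mul, mul_one, MulOpposite.op_zero, zero_smul, add_zero]
  congr 1
  refine Finset.prod_congr rfl fun l _ => ?_
  rw [show 0 + (1 + 0) * (l + 1) = 1 + 1 * l by ring]

/-- Jacobi's identity for the cube of the Euler product. -/
theorem hasSum_qProd_one_cube :
    HasSum (fun r : ℤ => monomial (tri r) (signWeight r)) (qProd 1 ^ 3) := by
  obtain ⟨D, hD, hlim⟩ := tendsto_triple_product (i := 1) (j := 0) (by norm_num)
    signWeight (dualTriple_eq 1 0)
  have h3 := (tendsto_add_atTop_iff_nat 1).mpr hlim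
  simp_rw [dualTriple_one_zero] at h3
  have h4 := tendsto_tprod (multipliable_apProd (-1) 1 one_pos)
  have h5 := (((tendsto_add_atTop_iff_nat 1).mpr h4).mul h4).const_mul (qProd (1 + 0))
  have h6 := tendsto_nhds_unique h3 h5
  have h7 : D = qProd 1 ^ 3 := by
    have h8 := qProd_eq_apProd 1
    rw [apProd] at h8
    rw [h6, ← h8]
    ring
  rw [h7] at hD
  refine hD.congr_fun fun r => ?_
  rw [thetaExp, one_mul, zero_mul, add_zero]

theorem qProd_one_eq_eProd : qProd 1 = eProd (fun _ => 1) := by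
  rw [qProd_eq_eProd one_pos]
  exact eProd_congr fun n _ => by simp

theorem prod_pair_eq_eProd (m : ℕ) :
    ∏ l ∈ Finset.range m, ((1 - X ^ (2 + 3 * l)) * (1 - X ^ (1 + 3 * l)) : ℚ⟦X⟧)
      = eProd (fun n => if n ≤ 3 * m ∧ ¬ 3 ∣ n then 1 else 0) := by
  induction m with
  | zero =>
    rw [Finset.prod_range_zero, eProd]
    symm
    refine (tprod_congr fun n => ?_).trans tprod_one
    rw [if_neg (by omega), pow_zero]
  | succ m ih =>
    rw [Finset.prod_range_succ, ih, ← eProd_single _ (show 0 < 2 + 3 * m by omega),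
      ← eProd_single _ (show 0 < 1 + 3 * m by omega), ← eProd_add, ← eProd_add]
    refine eProd_congr fun n hn => ?_
    split_ifs <;> omega

/-- By the product rule, the pair of factors with `y = X ^ (3l+1)` and `x = X ^ (3l+2) = X y`
contributes the logarithmic derivative `y / (1 - y) - x / (1 - x) = (1 - X) y / ((1 - x) (1 - y))`.
All contributions share the factor `1 - X`; the rest is nonnegative. -/
theorem dualTriple_two_one (m : ℕ) : ∃ S : ℚ⟦X⟧, NonnegCoeff S ∧ dualTriple 2 1 m
    = eProd (fun n => if n ≤ 3 * m ∧ ¬ 3 ∣ n then 1 else 0) * (1 - X ^ 1) * S := by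
  rw [← prod_pair_eq_eProd, dualTriple, ← Finset.prod_mul_distrib]
  induction m with
  | zero => exact ⟨0, fun n => by simp, by simp⟩
  | succ m ih =>
    obtain ⟨S, hS, hSm⟩ := ih
    have e2 := one_sub_X_pow_mul_inv (show 0 < 2 + 3 * m by omega)
    have e1 := one_sub_X_pow_mul_inv (show 0 < 1 + 3 * m by omega)
    have n2 := nonnegCoeff_one_sub_X_pow_inv (show 0 < 2 + 3 * m by omega)
    have n1 := nonnegCoeff_one_sub_X_pow_inv (show 0 < 1 + 3 * m by omega)
    refine ⟨S + X ^ (1 + 3 * m) * ((1 - X ^ (2 + 3 * m))⁻¹ * (1 - X ^ (1 + 3 * m))⁻¹),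
      hS.add ((nonnegCoeff_X_pow _).mul (n2.mul n1)), ?_⟩
    rw [Finset.prod_range_succ, TrivSqZeroExt.snd_mul, hSm, Finset.prod_range_succ, fst_prod_dual]
    simp only [TrivSqZeroExt.fst_mul, TrivSqZeroExt.fst_add, TrivSqZeroExt.fst_one, fst_dualMul,
      TrivSqZeroExt.snd_mul,
      TrivSqZeroExt.snd_add, TrivSqZeroExt.snd_one, snd_dualMul, MulOpposite.smul_eq_mul_unop,
      MulOpposite.unop_op, smul_eq_mul, map_neg, map_one]
    have e3 : ∏ l ∈ Finset.range m, ((1 + -1 * X ^ (2 + (2 + 1) * l))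
          * (1 + -1 * X ^ (1 + (2 + 1) * l)) : ℚ⟦X⟧)
        = ∏ l ∈ Finset.range m, ((1 - X ^ (2 + 3 * l)) * (1 - X ^ (1 + 3 * l))) :=
      Finset.prod_congr rfl fun l _ => by ring
    rw [e3]
    generalize ∏ l ∈ Finset.range m, ((1 - X ^ (2 + 3 * l)) * (1 - X ^ (1 + 3 * l)) : ℚ⟦X⟧) = N
    have e4 : (X : ℚ⟦X⟧) ^ (2 + 3 * m) = X * X ^ (1 + 3 * m) := by ring
    rw [show 2 + (2 + 1) * m = 2 + 3 * m by ring, show 1 + (2 + 1) * m = 1 + 3 * m by ring]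
    generalize (1 - X ^ (2 + 3 * m) : ℚ⟦X⟧)⁻¹ = B at *
    generalize (1 - X ^ (1 + 3 * m) : ℚ⟦X⟧)⁻¹ = A at *
    generalize (X : ℚ⟦X⟧) ^ (1 + 3 * m) = y at *
    generalize (X : ℚ⟦X⟧) ^ (2 + 3 * m) = x at *
    have e5 : (1 - x) * (1 - y) * (B * A) = (1 : ℚ⟦X⟧) := by
      linear_combination (1 - y) * A * e2 + e1
    linear_combination (-N * (1 - X) * y) * e5 - N * e4

/-- At each finite stage the product accompanying `S`, including `f₃` and the extra `1 - X`, has all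
exponents at most `2`. Dividing by `f₁²` therefore leaves inverse factors only, and nonnegativity
passes to the limit. -/
theorem exists_pentagonal_derivative :
    ∃ D, HasSum (fun r : ℤ => monomial (thetaExp 2 1 r) (signWeight r)) D ∧
      NonnegCoeff (D * eInv (fun _ => 2)) := by
  obtain ⟨D, hD, hlim⟩ := tendsto_triple_product (i := 2) (j := 1) (by norm_num)
    signWeight (dualTriple_eq 2 1)
  refine ⟨D, hD, ?_⟩
  choose S hS hSm using dualTriple_two_one
  simp_rw [hSm] at hlim
  refine nonnegCoeff_of_tendsto (hlim.mul_const (eInv fun _ => 2)) fun m => ?_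
  have e1 : eProd (fun n => (if 3 ∣ n then 1 else 0) + (if n ≤ 3 * m ∧ ¬ 3 ∣ n then 1 else 0)
        + (if n = 1 then 1 else 0)) * eInv (fun _ => 2)
      = eInv (fun n => 2 - ((if 3 ∣ n then 1 else 0) + (if n ≤ 3 * m ∧ ¬ 3 ∣ n then 1 else 0)
        + (if n = 1 then 1 else 0))) := by
    refine eProd_mul_eInv fun n _ => ?_
    split_ifs <;> omega
  rw [eProd_add, eProd_add, eProd_single 1 one_pos] at e1
  rw [show 2 + 1 = 3 from rfl, qProd_eq_eProd (show 0 < 3 by norm_num)]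
  have e2 := (nonnegCoeff_eInv (fun n => 2 - ((if 3 ∣ n then 1 else 0)
    + (if n ≤ 3 * m ∧ ¬ 3 ∣ n then 1 else 0) + (if n = 1 then 1 else 0)))).mul (hS m)
  rw [← e1] at e2
  convert e2 using 1
  ring

/-! ### Theta series and their dissections -/

theorem hasSum_shift_expand {p : ℕ} (hp : p ≠ 0) {e : ℤ → ℕ} {w : ℤ → ℚ} {F : ℚ⟦X⟧}
    (h : HasSum (fun t => monomial (e t) (w t)) F) (c : ℕ) :
    HasSum (fun t => monomial (p * e t + c) (w t)) (X ^ c * expand p hp F) := by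
  have h1 := (h.map (expand p hp) (continuous_expand hp)).mul_left (X ^ c)
  refine h1.congr_fun fun t => ?_
  rw [Function.comp_apply, expand_monomial, X_pow_eq, monomial_mul_monomial, one_mul, add_comm]

theorem hasSum_int_mod_three {f : ℤ → ℚ⟦X⟧} {A B D : ℚ⟦X⟧} (h0 : HasSum (fun t => f (3 * t)) A)
    (h1 : HasSum (fun t => f (3 * t + 1)) B) (h2 : HasSum (fun t => f (3 * t - 1)) D) :
    HasSum f (A + B + D) := by
  have := hasSum_int_residues (f := f) (m := 3) (by norm_num)
    (ρ := fun j => if j = 0 then 0 else if j = 1 then 1 else -1)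
    (A := fun j => if j = 0 then A else if j = 1 then B else D)
    (fun j hj => by interval_cases j <;> rfl)
    (fun j hj => by interval_cases j <;> simpa)
  simpa [Finset.sum_range_succ] using this

theorem hasSum_int_mod_five {f : ℤ → ℚ⟦X⟧} {A B D E G : ℚ⟦X⟧}
    (h0 : HasSum (fun t => f (5 * t)) A) (h1 : HasSum (fun t => f (5 * t + 1)) B)
    (h2 : HasSum (fun t => f (5 * t + 2)) D) (h3 : HasSum (fun t => f (5 * t - 2)) E)
    (h4 : HasSum (fun t => f (5 * t - 1)) G) :
    HasSum f (A + B + D + E + G) := by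
  have := hasSum_int_residues (f := f) (m := 5) (by norm_num)
    (ρ := fun j => if j = 0 then 0 else if j = 1 then 1 else if j = 2 then 2
      else if j = 3 then -2 else -1)
    (A := fun j => if j = 0 then A else if j = 1 then B else if j = 2 then D
      else if j = 3 then E else G)
    (fun j hj => by interval_cases j <;> rfl)
    (fun j hj => by interval_cases j <;> simpa)
  simpa [Finset.sum_range_succ] using this

theorem neg_one_zpow_mul_add {m : ℤ} (hm : Odd m) (t c : ℤ) :
    (-1 : ℚ) ^ (m * t + c) = (-1) ^ c * (-1) ^ t := by
  rw [zpow_add₀ (by norm_num), zpow_mul, hm.neg_one_zpow, mul_comm]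

/-- The theta series `∑ (-1) ^ r X ^ (i r (r + 1) / 2 + j r (r - 1) / 2)` as a product. -/
noncomputable def signedTheta (i j : ℕ) : ℚ⟦X⟧ :=
  qProd (i + j) * (apProd (-1) i (i + j) * apProd (-1) j (i + j))

theorem hasSum_signedTheta {i j : ℕ} (hij : 0 < i + j) :
    HasSum (fun r : ℤ => monomial (thetaExp i j r) ((-1) ^ r)) (signedTheta i j) :=
  hasSum_triple_product (by norm_num) hij

theorem signedTheta_eq_eProd {i j : ℕ} (hi : 0 < i) (hj : 0 < j) :
    signedTheta i j = eProd (fun n => (if (i + j) ∣ n then 1 else 0) +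
      ((if n % (i + j) = i % (i + j) then 1 else 0) +
        (if n % (i + j) = j % (i + j) then 1 else 0))) := by
  rw [signedTheta, qProd_eq_eProd (by omega), apProd_neg_one_eq_eProd hi (by omega),
    apProd_neg_one_eq_eProd hj (by omega), ← eProd_add, ← eProd_add]

theorem signedTheta_comm (i j : ℕ) : signedTheta i j = signedTheta j i := by
  rw [signedTheta, signedTheta, add_comm j i]
  ring

theorem signedTheta_one_zero : signedTheta 1 0 = 0 := by
  rw [signedTheta, apProd_eq_mul (-1) 0 (show 0 < 1 + 0 by norm_num)]
  simp

/-- Scaling both parameters of a theta series. -/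
theorem signedTheta_mul {p : ℕ} (hp : p ≠ 0) {i j : ℕ} (hij : 0 < i + j) :
    signedTheta (p * i) (p * j) = expand p hp (signedTheta i j) := by
  have h1 := hasSum_shift_expand hp (hasSum_signedTheta hij) 0
  rw [pow_zero, one_mul] at h1
  refine (hasSum_signedTheta (show 0 < p * i + p * j by
    rw [← mul_add]; exact Nat.mul_pos (Nat.pos_of_ne_zero hp) hij)).unique (h1.congr_fun fun t => ?_)
  rw [show thetaExp (p * i) (p * j) t = p * thetaExp i j t + 0 by
    rw [thetaExp, thetaExp]; ring]

/-- Euler's pentagonal number theorem. -/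
theorem qProd_one_eq_signedTheta : qProd 1 = signedTheta 2 1 := by
  rw [signedTheta_eq_eProd (by norm_num) (by norm_num), qProd_one_eq_eProd]
  refine eProd_congr fun n _ => ?_
  split_ifs <;> omega

theorem hasSum_weight_smul {e : ℤ → ℕ} {w : ℤ → ℚ} {F : ℚ⟦X⟧}
    (h : HasSum (fun t => monomial (e t) (w t)) F) (c : ℚ) :
    HasSum (fun t => monomial (e t) (c * w t)) (C c * F) := by
  refine (h.mul_left (C c)).congr_fun fun t => ?_
  rw [monomial_eq_C_mul_X_pow, monomial_eq_C_mul_X_pow, map_mul, mul_assoc]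

theorem hasSum_weight_add {e : ℤ → ℕ} {w v : ℤ → ℚ} {F G : ℚ⟦X⟧}
    (hF : HasSum (fun t => monomial (e t) (w t)) F)
    (hG : HasSum (fun t => monomial (e t) (v t)) G) :
    HasSum (fun t => monomial (e t) (w t + v t)) (F + G) :=
  (hF.add hG).congr_fun fun t => by rw [map_add]

theorem monomial_congr {e e' : ℕ} {w w' : ℚ} (he : (e : ℚ) = e') (hw : w = w') :
    (monomial e w : ℚ⟦X⟧) = monomial e' w' := by
  rw [Nat.cast_injective he, hw]

/-- The 3-dissection of `f₁ ^ 3`. -/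
theorem cube_dissection : ∃ P : ℚ⟦X⟧,
    qProd 1 ^ 3 = expand 3 (by norm_num) P - 3 * X * expand 3 (by norm_num) (qProd 3 ^ 3) ∧
      PosCoeff (P * eInv (fun _ => 2)) := by
  obtain ⟨D, hD, hD2⟩ := exists_pentagonal_derivative
  refine ⟨C 6 * D + qProd 1, ?_, ?_⟩
  · have hodd : Odd (3 : ℤ) := by decide
    -- For `r = 3t + 1` the weight is `(-1)^t (-3t - 1)`. The part `-(-1)^t` contributes nothing, by
    -- this vanishing theta series (its product contains `1 - X ^ 0`).
    have hz : HasSum (fun r : ℤ => (monomial (tri r) ((-1) ^ r) : ℚ⟦X⟧)) 0 := by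
      rw [← signedTheta_one_zero]
      refine (hasSum_signedTheta (by norm_num)).congr_fun fun r => ?_
      rw [thetaExp, one_mul, zero_mul, add_zero]
    have h0 := hasSum_shift_expand (p := 3) (by norm_num) (hasSum_weight_smul hD 3) 0
    have h1 := hasSum_shift_expand (p := 9) (by norm_num) (hasSum_weight_add
      (hasSum_weight_smul hasSum_qProd_one_cube (-3)) (hasSum_weight_smul hz (-1))) 1
    -- Replacing `t` by `-t` turns the exponents for `r = 3t - 1` into those for `r = 3t`; both
    -- classes thus give `3 D`, and this one also `f₁`.
    have h2 := (Equiv.neg ℤ).hasSum_iff.mpr (hasSum_shift_expand (p := 3) (by norm_num)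
      (hasSum_weight_add (hasSum_weight_smul hD 3)
        (hasSum_signedTheta (show 0 < 2 + 1 by norm_num))) 0)
    have key := hasSum_int_mod_three (f := fun r => monomial (tri r) (signWeight r))
      (h0.congr_fun fun t => ?_) (h1.congr_fun fun t => ?_) (h2.congr_fun fun t => ?_)
    · rw [hasSum_qProd_one_cube.unique key, ← qProd_one_eq_signedTheta, map_pow]
      simp only [map_add, map_mul, map_pow, expand_C, mul_zero, add_zero, map_neg,
        expand_qProd _ one_pos, expand_qProd _ (show 0 < 3 by norm_num)]
      rw [show (C (6 : ℚ) : ℚ⟦X⟧) = 6 from map_ofNat C 6,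
        show (C (3 : ℚ) : ℚ⟦X⟧) = 3 from map_ofNat C 3]
      ring_nf
    · refine monomial_congr (by push_cast [tri_cast, thetaExp_cast]; ring) ?_
      have := neg_one_zpow_mul_add hodd t 0
      simp only [add_zero, zpow_zero, one_mul] at this
      rw [signWeight, signWeight, this]
      push_cast
      ring
    · refine monomial_congr (by push_cast [tri_cast, thetaExp_cast]; ring) ?_
      rw [signWeight, signWeight, neg_one_zpow_mul_add hodd t 1]
      push_cast
      ring
    · have hneg : (-1 : ℚ) ^ (-t) = (-1) ^ t := by
        rw [zpow_neg, ← inv_zpow, inv_neg, inv_one]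
      refine monomial_congr (by push_cast [tri_cast, thetaExp_cast, Equiv.neg_apply]; ring) ?_
      rw [signWeight, signWeight, sub_eq_add_neg, neg_one_zpow_mul_add hodd t (-1),
        Equiv.neg_apply, hneg]
      push_cast
      norm_num
      ring
  · have h1 : qProd 1 * eInv (fun _ => 2) = eInv (fun _ => 1) := by
      rw [qProd_one_eq_eProd]
      exact eProd_mul_eInv fun n _ => rfl
    rw [add_mul, h1, add_comm, mul_assoc]
    refine (posCoeff_eInv le_rfl).add (NonnegCoeff.mul (fun n => ?_) hD2)
    rw [coeff_C]
    split_ifs <;> norm_num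

/-- The 3-dissection of `f₁`. -/
theorem qProd_one_dissection_three :
    qProd 1 = expand 3 (by norm_num) (signedTheta 5 4)
      - X * expand 3 (by norm_num) (signedTheta 2 7)
      - X ^ 2 * expand 3 (by norm_num) (signedTheta 8 1) := by
  have hodd : Odd (3 : ℤ) := by decide
  have h0 := hasSum_shift_expand (p := 3) (by norm_num)
    (hasSum_signedTheta (show 0 < 5 + 4 by norm_num)) 0
  have h1 := hasSum_weight_smul (hasSum_shift_expand (p := 3) (by norm_num)
    (hasSum_signedTheta (show 0 < 8 + 1 by norm_num)) 2) (-1)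
  have h2 := hasSum_weight_smul (hasSum_shift_expand (p := 3) (by norm_num)
    (hasSum_signedTheta (show 0 < 2 + 7 by norm_num)) 1) (-1)
  have key := hasSum_int_mod_three (f := fun r => monomial (thetaExp 2 1 r) ((-1) ^ r))
    (h0.congr_fun fun t => ?_) (h1.congr_fun fun t => ?_) (h2.congr_fun fun t => ?_)
  · rw [qProd_one_eq_signedTheta, (hasSum_signedTheta (by norm_num)).unique key]
    simp only [map_neg, map_one]
    ring
  · refine monomial_congr (by push_cast [thetaExp_cast]; ring) ?_
    simpa using neg_one_zpow_mul_add hodd t 0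
  · refine monomial_congr (by push_cast [thetaExp_cast]; ring) ?_
    simpa using neg_one_zpow_mul_add hodd t 1
  · refine monomial_congr (by push_cast [thetaExp_cast]; ring) ?_
    rw [sub_eq_add_neg]
    exact (neg_one_zpow_mul_add hodd t (-1)).trans (by norm_num)

/-- The 3-dissection of `f₁ ^ 2 / f₂`. -/
theorem signedTheta_one_one_dissection :
    signedTheta 1 1 = expand 3 (by norm_num) (signedTheta 3 3)
      - 2 * X * expand 3 (by norm_num) (signedTheta 1 5) := by
  have hodd : Odd (3 : ℤ) := by decide
  have h0 := hasSum_shift_expand (p := 3) (by norm_num)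
    (hasSum_signedTheta (show 0 < 3 + 3 by norm_num)) 0
  have h1 := hasSum_weight_smul (hasSum_shift_expand (p := 3) (by norm_num)
    (hasSum_signedTheta (show 0 < 5 + 1 by norm_num)) 1) (-1)
  have h2 := hasSum_weight_smul (hasSum_shift_expand (p := 3) (by norm_num)
    (hasSum_signedTheta (show 0 < 1 + 5 by norm_num)) 1) (-1)
  have key := hasSum_int_mod_three (f := fun r => monomial (thetaExp 1 1 r) ((-1) ^ r))
    (h0.congr_fun fun t => ?_) (h1.congr_fun fun t => ?_) (h2.congr_fun fun t => ?_)
  · rw [(hasSum_signedTheta (by norm_num)).unique key, signedTheta_comm 5 1]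
    simp only [map_neg, map_one]
    ring
  · refine monomial_congr (by push_cast [thetaExp_cast]; ring) ?_
    simpa using neg_one_zpow_mul_add hodd t 0
  · refine monomial_congr (by push_cast [thetaExp_cast]; ring) ?_
    simpa using neg_one_zpow_mul_add hodd t 1
  · refine monomial_congr (by push_cast [thetaExp_cast]; ring) ?_
    rw [sub_eq_add_neg]
    exact (neg_one_zpow_mul_add hodd t (-1)).trans (by norm_num)

/-- The 5-dissection of `f₁`. -/
theorem qProd_one_dissection_five :
    qProd 1 = expand 5 (by norm_num) (signedTheta 8 7 + X * signedTheta 2 13)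
      - X * expand 5 (by norm_num) (qProd 5)
      - X ^ 2 * expand 5 (by norm_num) (signedTheta 11 4 - X * signedTheta 14 1) := by
  have hodd : Odd (5 : ℤ) := by decide
  have h0 := hasSum_shift_expand (p := 5) (by norm_num)
    (hasSum_signedTheta (show 0 < 8 + 7 by norm_num)) 0
  have h1 := hasSum_weight_smul (hasSum_shift_expand (p := 5) (by norm_num)
    (hasSum_signedTheta (show 0 < 11 + 4 by norm_num)) 2) (-1)
  have h2 := hasSum_shift_expand (p := 5) (by norm_num)
    (hasSum_signedTheta (show 0 < 14 + 1 by norm_num)) 7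
  have h3 := hasSum_shift_expand (p := 5) (by norm_num)
    (hasSum_signedTheta (show 0 < 2 + 13 by norm_num)) 5
  have h4 := hasSum_weight_smul (hasSum_shift_expand (p := 5) (by norm_num)
    (hasSum_signedTheta (show 0 < 5 + 10 by norm_num)) 1) (-1)
  have key := hasSum_int_mod_five (f := fun r => monomial (thetaExp 2 1 r) ((-1) ^ r))
    (h0.congr_fun fun t => ?_) (h1.congr_fun fun t => ?_) (h2.congr_fun fun t => ?_)
    (h3.congr_fun fun t => ?_) (h4.congr_fun fun t => ?_)
  · have h5 : signedTheta 5 10 = qProd 5 := by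
      have h6 := signedTheta_mul (p := 5) (by norm_num) (show 0 < 2 + 1 by norm_num)
      rw [← qProd_one_eq_signedTheta, expand_qProd _ one_pos] at h6
      rw [signedTheta_comm]
      exact h6
    rw [qProd_one_eq_signedTheta, (hasSum_signedTheta (by norm_num)).unique key, h5]
    simp only [map_neg, map_one, map_add, map_sub, map_mul, expand_X]
    ring
  · refine monomial_congr (by push_cast [thetaExp_cast]; ring) ?_
    simpa using neg_one_zpow_mul_add hodd t 0
  · refine monomial_congr (by push_cast [thetaExp_cast]; ring) ?_
    simpa using neg_one_zpow_mul_add hodd t 1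
  · refine monomial_congr (by push_cast [thetaExp_cast]; ring) ?_
    exact (neg_one_zpow_mul_add hodd t 2).trans (by norm_num)
  · refine monomial_congr (by push_cast [thetaExp_cast]; ring) ?_
    rw [sub_eq_add_neg]
    exact (neg_one_zpow_mul_add hodd t (-2)).trans (by norm_num)
  · refine monomial_congr (by push_cast [thetaExp_cast]; ring) ?_
    rw [sub_eq_add_neg]
    exact (neg_one_zpow_mul_add hodd t (-1)).trans (by norm_num)

/-! ### Coefficients of theta series -/

theorem hasSum_coeff_theta {e : ℤ → ℕ} {w : ℤ → ℚ} {F : ℚ⟦X⟧}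
    (h : HasSum (fun r => monomial (e r) (w r)) F) (d : ℕ) :
    HasSum (fun r => if d = e r then w r else 0) (coeff d F) := by
  have := (PowerSeries.WithPiTopology.hasSum_iff_hasSum_coeff ℚ).mp h d
  simpa only [coeff_monomial] using this

theorem coeff_theta_eq_zero {e : ℤ → ℕ} {w : ℤ → ℚ} {F : ℚ⟦X⟧}
    (h : HasSum (fun r => monomial (e r) (w r)) F) {d : ℕ} (hd : ∀ r, e r ≠ d) :
    coeff d F = 0 := by
  refine (hasSum_coeff_theta h d).unique (hasSum_zero.congr_fun fun r => ?_)
  rw [if_neg (hd r).symm]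

theorem coeff_theta_nonneg {e : ℤ → ℕ} {F : ℚ⟦X⟧}
    (h : HasSum (fun r => monomial (e r) (1 : ℚ)) F) (d : ℕ) : 0 ≤ coeff d F :=
  (hasSum_coeff_theta h d).nonneg fun r => by split_ifs <;> norm_num

theorem coeff_theta_pos {e : ℤ → ℕ} {F : ℚ⟦X⟧}
    (h : HasSum (fun r => monomial (e r) (1 : ℚ)) F) (r : ℤ) : 0 < coeff (e r) F := by
  have h1 := le_hasSum (hasSum_coeff_theta h (e r)) r
    fun s _ => by split_ifs <;> norm_num
  rw [if_pos rfl] at h1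
  linarith

/-! ### Quotients -/

theorem eq_mk_of_mul_eq {N D F : ℚ⟦X⟧} {a : ℕ → ℚ} (h : N * D⁻¹ = mk a)
    (hD : constantCoeff D = 1) (hF : F * D = N) (n : ℕ) : a n = coeff n F := by
  have : F = mk a := by
    rw [← h, ← hF, mul_assoc, PowerSeries.mul_inv_cancel _ (by simp [hD]), mul_one]
  rw [this, coeff_mk]

theorem qProd_mul_eInv {k : ℕ} (hk : 0 < k) :
    qProd k * eInv (fun n => if k ∣ n then 1 else 0) = 1 := by
  rw [qProd_eq_eProd hk, eProd_mul_eInv_self]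

theorem eInv_dvd_eq_expand {k : ℕ} (hk : 0 < k) :
    eInv (fun n => if k ∣ n then 1 else 0) = expand k hk.ne' (eInv fun _ => 1) := by
  have h1 : qProd k * expand k hk.ne' (eInv fun _ => 1) = 1 := by
    have := congrArg (expand k hk.ne') (eProd_mul_eInv_self fun _ => 1)
    rwa [map_mul, map_one, ← qProd_one_eq_eProd, expand_qProd hk.ne' one_pos, mul_one] at this
  exact (left_inv_eq_right_inv (by rw [mul_comm]; exact qProd_mul_eInv hk) h1)

theorem coeff_mul_eInv_dvd {k : ℕ} (hk : 0 < k) (F : ℚ⟦X⟧) (n : ℕ) :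
    coeff n (F * eInv (fun n => if k ∣ n then 1 else 0)) =
      ∑ x ∈ Finset.HasAntidiagonal.antidiagonal n,
        coeff x.1 F * if k ∣ x.2 then coeff (x.2 / k) (eInv fun _ => 1) else 0 := by
  rw [eInv_dvd_eq_expand hk, coeff_mul]
  simp_rw [coeff_expand]

/-- `1 / f_k` has a positive coefficient at every multiple of `k` and zeros elsewhere. So the
coefficient at `n` is a positive combination of the coefficients of `F` at all `u ≤ n` congruent to
`n`. -/
theorem coeff_mul_eInv_dvd_pos {k : ℕ} (hk : 0 < k) {F : ℚ⟦X⟧} {n : ℕ}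
    (h : ∀ u ≤ n, u ≡ n [MOD k] → 0 ≤ coeff u F)
    (h' : ∃ u ≤ n, u ≡ n [MOD k] ∧ 0 < coeff u F) :
    0 < coeff n (F * eInv (fun n => if k ∣ n then 1 else 0)) := by
  have hpos : PosCoeff (eInv fun _ => 1) := posCoeff_eInv le_rfl
  rw [coeff_mul_eInv_dvd hk]
  refine Finset.sum_pos' (fun x hx => ?_) ?_
  · rw [Finset.HasAntidiagonal.mem_antidiagonal] at hx
    split_ifs with hd
    · refine mul_nonneg (h _ (by omega) ?_) (hpos _).le
      refine (Nat.modEq_iff_dvd' (by omega)).mpr ?_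
      rwa [show n - x.1 = x.2 by omega]
    · rw [mul_zero]
  · obtain ⟨u, hu, hmod, hup⟩ := h'
    refine ⟨(u, n - u), by rw [Finset.HasAntidiagonal.mem_antidiagonal]; exact Nat.add_sub_cancel' hu, ?_⟩
    rw [if_pos ((Nat.modEq_iff_dvd' hu).mp hmod)]
    exact mul_pos hup (hpos _)

theorem coeff_mul_eInv_dvd_eq_zero {k : ℕ} (hk : 0 < k) {F : ℚ⟦X⟧} {n : ℕ}
    (h : ∀ u ≤ n, u ≡ n [MOD k] → coeff u F = 0) :
    coeff n (F * eInv (fun n => if k ∣ n then 1 else 0)) = 0 := by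
  rw [coeff_mul_eInv_dvd hk]
  refine Finset.sum_eq_zero fun x hx => ?_
  rw [Finset.HasAntidiagonal.mem_antidiagonal] at hx
  split_ifs with hd
  · rw [h _ (by omega), zero_mul]
    refine (Nat.modEq_iff_dvd' (by omega)).mpr ?_
    rwa [show n - x.1 = x.2 by omega]
  · rw [mul_zero]

theorem coeff_mul_eInv_dvd_neg {k : ℕ} (hk : 0 < k) {F : ℚ⟦X⟧} {n : ℕ}
    (h : ∀ u ≤ n, u ≡ n [MOD k] → coeff u F ≤ 0)
    (h' : ∃ u ≤ n, u ≡ n [MOD k] ∧ coeff u F < 0) :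
    coeff n (F * eInv (fun n => if k ∣ n then 1 else 0)) < 0 := by
  have := coeff_mul_eInv_dvd_pos hk (F := -F) (n := n)
    (fun u hu hm => by rw [map_neg]; linarith [h u hu hm])
    (by
      obtain ⟨u, hu, hm, hn⟩ := h'
      exact ⟨u, hu, hm, by rw [map_neg]; linarith⟩)
  rw [neg_mul, map_neg] at this
  linarith

/-- The least value in the class of `n` is at most `signBound g m + m < n + m`. Were it larger than
`n`, congruence would make it at least `n + m`. -/
theorem exists_le_of_signBound_lt {g : ℕ → ℕ} {m : ℕ} (hm : 0 < m) {n : ℕ}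
    (hn : signBound g m < n) (h : ∃ r < m, n ≡ g r [MOD m]) :
    ∃ r, g r ≤ n ∧ g r ≡ n [MOD m] := by
  obtain ⟨r, hr, hnr⟩ := h
  have hne : {w | ∃ r' < m, g r' ≡ g r % m [MOD m] ∧ w = g r'}.Nonempty :=
    ⟨g r, r, hr, (Nat.mod_modEq _ _).symm, rfl⟩
  have hv : sInf {w | ∃ r' < m, g r' ≡ g r % m [MOD m] ∧ w = g r'} ∈ leastValues g m :=
    ⟨g r % m, Nat.mod_lt _ hm, Nat.sInf_mem hne, fun _ hw => Nat.sInf_le hw⟩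
  have hle := (isGreatest_leastValues g hm).2 hv
  obtain ⟨r', -, hr', hw⟩ := Nat.sInf_mem hne
  have hmod : g r' ≡ n [MOD m] := (hr'.trans (Nat.mod_modEq _ _)).trans hnr.symm
  refine ⟨r', ?_, hmod⟩
  by_contra! hlt
  obtain ⟨t, ht⟩ := (Nat.modEq_iff_dvd' hlt.le).mp hmod.symm
  have ht0 : 0 < t := by
    rcases Nat.eq_zero_or_pos t with h0 | h0
    · rw [h0] at ht; omega
    · exact h0
  have : m ≤ m * t := Nat.le_mul_of_pos_right m ht0
  rw [signBound] at hn
  omega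

/-! ### The series `f₂ ^ 2 / (f₁ f_p)` -/

theorem qProd_one_mul_apProd : qProd 1 * apProd 1 1 1 = qProd 2 := by
  rw [qProd_eq_apProd 1, qProd_eq_apProd 2, mul_comm, apProd_one_mul_neg_one 1 one_pos, mul_one]

/-- Gauss' formula for the generating function of the triangular numbers. -/
theorem exists_triangular_series : ∃ F : ℚ⟦X⟧,
    HasSum (fun r : ℤ => monomial (tri r) (1 : ℚ)) F ∧ F * qProd 1 = C 2 * qProd 2 ^ 2 := by
  have h := hasSum_triple_product (s := 1) (by norm_num) (show 0 < 1 + 0 by norm_num)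
  refine ⟨_, h.congr_fun fun r => ?_, ?_⟩
  · rw [one_zpow, thetaExp, one_mul, zero_mul, add_zero]
  -- The initial factor `1 + X ^ 0` is the constant `2`: the sum over `ℤ` meets every triangular
  -- number twice, at `r` and `-1 - r`.
  · rw [apProd_eq_mul 1 0 (show 0 < 1 + 0 by norm_num), ← qProd_one_mul_apProd]
    simp only [map_one, add_zero, zero_add, pow_zero, mul_one]
    rw [show (C (2 : ℚ) : ℚ⟦X⟧) = 2 from map_ofNat C 2]
    ring

theorem tri_natCast (r : ℕ) : tri r = r * (r + 1) / 2 := by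
  have : 2 * tri r = r * (r + 1) := by exact_mod_cast two_mul_tri r
  omega

/-- `2 tri r = r (r + 1)` depends only on `r` modulo `p`, and `2` is invertible modulo an odd `p`.
-/
theorem tri_modEq {p : ℕ} (hp : Odd p) (r : ℤ) : ∃ t < p, tri r ≡ t * (t + 1) / 2 [MOD p] := by
  have hp0 : (0 : ℤ) < p := by exact_mod_cast hp.pos
  have h1 := Int.emod_nonneg r hp0.ne'
  have h2 := Int.emod_lt_of_pos r hp0
  refine ⟨(r % p).toNat, by omega, ?_⟩
  rw [← tri_natCast, Int.toNat_of_nonneg h1]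
  have h3 : (2 * tri r : ℤ) ≡ 2 * tri (r % p) [ZMOD p] := by
    rw [two_mul_tri, two_mul_tri]
    exact (Int.mod_modEq r p).symm.mul ((Int.mod_modEq r p).symm.add_right 1)
  have h4 : 2 * tri r ≡ 2 * tri (r % p) [MOD p] := by
    rw [← Int.natCast_modEq_iff]
    exact_mod_cast h3
  exact Nat.ModEq.cancel_left_of_coprime hp.coprime_two_right h4

theorem sign_triangular_quotient {p : ℕ} (hp : Odd p) {a : ℕ → ℚ}
    (ha : qProd 2 ^ 2 * (qProd 1 * qProd p)⁻¹ = PowerSeries.mk a) {n : ℕ}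
    (hn : signBound (fun r => r * (r + 1) / 2) p < (n : ℤ)) :
    ((∃ r < p, n ≡ r * (r + 1) / 2 [MOD p]) → 0 < a n) ∧
      ((¬ ∃ r < p, n ≡ r * (r + 1) / 2 [MOD p]) → a n = 0) := by
  obtain ⟨F, hF, hF2⟩ := exists_triangular_series
  have h1 : 2 * a n = coeff n (F * eInv (fun n => if p ∣ n then 1 else 0)) := by
    have h2 := eq_mk_of_mul_eq (F := C (1 / 2) * F * eInv (fun n => if p ∣ n then 1 else 0)) ha
      (by rw [map_mul, constantCoeff_qProd one_pos, constantCoeff_qProd hp.pos, one_mul]) (by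
        have h3 : C (1 / 2 : ℚ) * C 2 = (1 : ℚ⟦X⟧) := by rw [← map_mul]; norm_num
        linear_combination C (1 / 2 : ℚ) * F * qProd 1 * qProd_mul_eInv hp.pos
          + C (1 / 2 : ℚ) * hF2 + qProd 2 ^ 2 * h3) n
    rw [h2, mul_assoc, coeff_C_mul]
    ring
  constructor
  · intro h
    have h3 : 0 < coeff n (F * eInv (fun n => if p ∣ n then 1 else 0)) := by
      refine coeff_mul_eInv_dvd_pos hp.pos (fun u _ _ => coeff_theta_nonneg hF u) ?_
      obtain ⟨r, hr, hmod⟩ := exists_le_of_signBound_lt hp.pos hn h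
      refine ⟨_, hr, hmod, ?_⟩
      rw [← tri_natCast]
      exact coeff_theta_pos hF r
    linarith
  · intro h
    have h3 : coeff n (F * eInv (fun n => if p ∣ n then 1 else 0)) = 0 := by
      refine coeff_mul_eInv_dvd_eq_zero hp.pos fun u _ hu => coeff_theta_eq_zero hF fun r hr => h ?_
      obtain ⟨t, ht, htm⟩ := tri_modEq hp r
      exact ⟨t, ht, hu.symm.trans (hr ▸ htm)⟩
    linarith

/-! ### The series `f₁ ^ 2 / (f₂ f_{4p})` -/

theorem thetaExp_one_one (r : ℤ) : thetaExp 1 1 r = r.natAbs ^ 2 := by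
  have h := thetaExp_cast 1 1 r
  have h2 : ((r.natAbs ^ 2 : ℕ) : ℚ) = r ^ 2 := by
    have : ((r.natAbs ^ 2 : ℕ) : ℤ) = r ^ 2 := by push_cast; exact sq_abs r
    rw [← Int.cast_natCast, this, Int.cast_pow]
  refine Nat.cast_injective (R := ℚ) ?_
  rw [h, h2]
  push_cast
  ring

/-- The theta series `∑ X ^ (r ^ 2)`. -/
noncomputable def squareTheta : ℚ⟦X⟧ := qProd 2 * (apProd 1 1 2 * apProd 1 1 2)

theorem hasSum_squareTheta :
    HasSum (fun r : ℤ => monomial (r.natAbs ^ 2) (1 : ℚ)) squareTheta := by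
  refine (hasSum_triple_product (s := 1) (by norm_num) (show 0 < 1 + 1 by norm_num)).congr_fun
    fun r => ?_
  rw [one_zpow, thetaExp_one_one]

/-- The exponent `r²` has the parity of `r`, so the sign `(-1) ^ r` depends on the exponent alone.
-/
theorem coeff_signedTheta_one_one (d : ℕ) :
    coeff d (signedTheta 1 1) = (-1) ^ d * coeff d squareTheta := by
  have h1 := hasSum_coeff_theta (hasSum_signedTheta (show 0 < 1 + 1 by norm_num)) d
  have h2 := (hasSum_coeff_theta hasSum_squareTheta d).mul_left ((-1 : ℚ) ^ d)
  refine h1.unique (h2.congr_fun fun r => ?_)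
  rw [thetaExp_one_one]
  split_ifs with h
  · rw [h, mul_one]
    rcases Int.even_or_odd r with hr | hr
    · rw [hr.neg_one_zpow, Even.neg_one_pow]
      exact (Int.natAbs_even.mpr hr).pow_of_ne_zero (by norm_num)
    · rw [hr.neg_one_zpow, Odd.neg_one_pow]
      exact (Int.natAbs_odd.mpr hr).pow
  · rw [mul_zero]

theorem qProd_one_eq_mul : qProd 1 = apProd (-1) 1 2 * qProd 2 := by
  rw [qProd_one_eq_eProd, qProd_eq_eProd two_pos,
    apProd_neg_one_eq_eProd one_pos (show 1 ≤ 2 by norm_num), ← eProd_add]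
  refine eProd_congr fun n _ => ?_
  split_ifs <;> omega

theorem signedTheta_one_one_mul : signedTheta 1 1 * qProd 2 = qProd 1 ^ 2 := by
  rw [qProd_one_eq_mul, signedTheta]
  ring

theorem squareTheta_mul : squareTheta * (qProd 1 ^ 2 * qProd 4 ^ 2) = qProd 2 ^ 5 := by
  have h1 := apProd_one_mul_neg_one 1 two_pos
  have h2 : qProd 2 = apProd (-1) 2 4 * qProd 4 := by
    rw [qProd_eq_eProd two_pos, qProd_eq_eProd four_pos,
      apProd_neg_one_eq_eProd two_pos (show 2 ≤ 4 by norm_num), ← eProd_add]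
    refine eProd_congr fun n _ => ?_
    split_ifs <;> omega
  rw [qProd_one_eq_mul, squareTheta]
  norm_num at h1
  rw [← h1] at h2
  calc _ = qProd 2 ^ 3 * (apProd 1 1 2 * apProd (-1) 1 2 * qProd 4) ^ 2 := by ring
    _ = _ := by rw [← h2]; ring

theorem exists_eq_sq_of_coeff_ne_zero {d : ℕ} (h : coeff d squareTheta ≠ 0) :
    ∃ r : ℕ, r ^ 2 = d := by
  by_contra! h1
  exact h (coeff_theta_eq_zero hasSum_squareTheta fun r => h1 _)

theorem coeff_squareTheta_nonneg (d : ℕ) : 0 ≤ coeff d squareTheta :=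
  coeff_theta_nonneg hasSum_squareTheta d

theorem coeff_squareTheta_pos (r : ℕ) : 0 < coeff (r ^ 2) squareTheta := by
  simpa using coeff_theta_pos hasSum_squareTheta r

theorem sq_modEq_odd_or_even {p n r : ℕ} (hp : 0 < p) (h : n ≡ r ^ 2 [MOD 4 * p]) :
    (∃ t < p, n ≡ 4 * t ^ 2 + 4 * t + 1 [MOD 4 * p]) ∨ ∃ t < p, n ≡ 4 * t ^ 2 [MOD 4 * p] := by
  rcases Nat.even_or_odd' r with ⟨s, rfl | rfl⟩
  · refine Or.inr ⟨s % p, Nat.mod_lt _ hp, h.trans ?_⟩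
    rw [show (2 * s) ^ 2 = 4 * s ^ 2 by ring]
    exact Nat.ModEq.mul_left' 4 ((Nat.mod_modEq s p).symm.pow 2)
  · refine Or.inl ⟨s % p, Nat.mod_lt _ hp, h.trans ?_⟩
    rw [show (2 * s + 1) ^ 2 = 4 * (s ^ 2 + s) + 1 by ring,
      show 4 * (s % p) ^ 2 + 4 * (s % p) + 1 = 4 * ((s % p) ^ 2 + s % p) + 1 by ring]
    exact (Nat.ModEq.mul_left' 4 (((Nat.mod_modEq s p).symm.pow 2).add
      (Nat.mod_modEq s p).symm)).add_right 1

/-- Chinese remainder theorem: squares modulo `4p` are the squares modulo `4`, namely `0` and `1`,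
combined with the squares modulo `p`. -/
theorem exists_sq_modEq_iff {p n : ℕ} (hp : p = 1 ∨ (p.Prime ∧ Odd p)) :
    (∃ r : ℕ, n ≡ r ^ 2 [MOD 4 * p]) ↔
      ¬ (n % 4 = 2 ∨ n % 4 = 3 ∨ jacobiSym (n : ℤ) p = -1) := by
  constructor
  · rintro ⟨r, hr⟩
    have h4 : n % 4 = r ^ 2 % 4 := hr.of_mul_right p
    have hr4 : r ^ 2 % 4 = 0 ∨ r ^ 2 % 4 = 1 := by
      have : r % 4 < 4 := Nat.mod_lt _ (by norm_num)
      rw [Nat.pow_mod]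
      interval_cases r % 4 <;> simp
    rintro (h | h | h)
    · omega
    · omega
    · have h1 : (n : ℤ) % p = ((r : ℤ) ^ 2) % p := by
        exact_mod_cast congrArg (Nat.cast : ℕ → ℤ) (hr.of_mul_left 4)
      rw [jacobiSym.mod_left, h1, ← jacobiSym.mod_left, jacobiSym.pow_left] at h
      nlinarith [sq_nonneg (jacobiSym (r : ℤ) p)]
  · intro h
    push Not at h
    obtain ⟨h2, h3, hj⟩ := h
    have hsq : ∃ x : ℕ, n ≡ x ^ 2 [MOD p] := by
      rcases hp with rfl | ⟨hp, -⟩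
      · exact ⟨0, Nat.modEq_one⟩
      · have := Fact.mk hp
        rw [← jacobiSym.legendreSym.to_jacobiSym, Ne, legendreSym.eq_neg_one_iff, not_not] at hj
        obtain ⟨y, hy⟩ := hj
        refine ⟨y.val, ?_⟩
        rw [← ZMod.natCast_eq_natCast_iff]
        push_cast at hy ⊢
        rw [ZMod.natCast_zmod_val, hy, sq]
    have hodd : Odd p := by
      rcases hp with rfl | ⟨-, hp⟩
      · exact odd_one
      · exact hp
    obtain ⟨x, hx⟩ := hsq
    -- Adding the odd number `p` changes the parity of the root but not its class modulo `p`;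
    -- matching parity is enough modulo `4`, as `n` is `0` or `1` there.
    obtain ⟨r, hr, hrn⟩ : ∃ r, n ≡ r ^ 2 [MOD p] ∧ r % 2 = n % 2 := by
      by_cases hxn : x % 2 = n % 2
      · exact ⟨x, hx, hxn⟩
      · refine ⟨x + p, hx.trans ?_, ?_⟩
        · exact (Nat.add_modEq_right (a := x) (n := p)).symm.pow 2
        · obtain ⟨k, rfl⟩ := hodd
          omega
    refine ⟨r, (Nat.modEq_and_modEq_iff_modEq_mul ?_).mp ⟨?_, hr⟩⟩
    · have : Nat.Coprime (2 ^ 2) p := Nat.Coprime.pow_left 2 hodd.coprime_two_left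
      exact this
    · have hr4 : r % 4 < 4 := Nat.mod_lt _ (by norm_num)
      have hn4 : n % 4 < 4 := Nat.mod_lt _ (by norm_num)
      have e1 : r % 4 % 2 = n % 4 % 2 := by omega
      rw [Nat.ModEq, Nat.pow_mod]
      interval_cases r % 4 <;> interval_cases n % 4 <;> simp_all

theorem sign_square_quotient {p : ℕ} (hp : p = 1 ∨ (p.Prime ∧ Odd p)) {a : ℕ → ℚ}
    (ha : qProd 1 ^ 2 * (qProd 2 * qProd (4 * p))⁻¹ = PowerSeries.mk a) {n : ℕ}
    (hn : signBound (fun r => r ^ 2) (4 * p) < (n : ℤ)) :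
    ((∃ t < p, n ≡ 4 * t ^ 2 + 4 * t + 1 [MOD 4 * p]) → a n < 0) ∧
      ((∃ t < p, n ≡ 4 * t ^ 2 [MOD 4 * p]) → 0 < a n) ∧
      (((¬ ∃ t < p, n ≡ 4 * t ^ 2 + 4 * t + 1 [MOD 4 * p]) ∧
        (¬ ∃ t < p, n ≡ 4 * t ^ 2 [MOD 4 * p])) → a n = 0) ∧
      (((¬ ∃ t < p, n ≡ 4 * t ^ 2 + 4 * t + 1 [MOD 4 * p]) ∧
        (¬ ∃ t < p, n ≡ 4 * t ^ 2 [MOD 4 * p])) ↔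
          (n % 4 = 2 ∨ n % 4 = 3 ∨ jacobiSym (n : ℤ) p = -1)) := by
  have hp0 : 0 < p := by
    rcases hp with rfl | ⟨hp, -⟩
    · exact one_pos
    · exact hp.pos
  have h4p : 0 < 4 * p := by omega
  have h1 : a n = coeff n (signedTheta 1 1 * eInv (fun n => if 4 * p ∣ n then 1 else 0)) :=
    eq_mk_of_mul_eq ha
      (by rw [map_mul, constantCoeff_qProd two_pos, constantCoeff_qProd h4p, one_mul])
      (by linear_combination signedTheta 1 1 * qProd 2 * qProd_mul_eInv h4p
            + signedTheta_one_one_mul) n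
  have hparity : ∀ u, u ≡ n [MOD 4 * p] → u % 4 = n % 4 := fun u hu => hu.of_mul_right p
  refine ⟨?_, ?_, ?_, ?_⟩
  · rintro ⟨t, ht, hnt⟩
    have hn1 : n % 4 = 1 := by
      rw [← hparity _ hnt.symm]
      omega
    rw [h1]
    have hodd : ∀ u, u ≡ n [MOD 4 * p] → (-1 : ℚ) ^ u = -1 := fun u hu => by
      have := hparity u hu
      exact Odd.neg_one_pow (Nat.odd_iff.mpr (by omega))
    refine coeff_mul_eInv_dvd_neg h4p (fun u _ hu => ?_) ?_
    · rw [coeff_signedTheta_one_one, hodd u hu]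
      linarith [coeff_squareTheta_nonneg u]
    · obtain ⟨r, hr, hrm⟩ := exists_le_of_signBound_lt h4p hn
        ⟨2 * t + 1, by omega, by
          simpa only [show (2 * t + 1) ^ 2 = 4 * t ^ 2 + 4 * t + 1 by ring] using hnt⟩
      refine ⟨_, hr, hrm, ?_⟩
      rw [coeff_signedTheta_one_one, hodd _ hrm]
      linarith [coeff_squareTheta_pos r]
  · rintro ⟨t, ht, hnt⟩
    have hn1 : n % 4 = 0 := by
      rw [← hparity _ hnt.symm]
      omega
    rw [h1]
    have heven : ∀ u, u ≡ n [MOD 4 * p] → (-1 : ℚ) ^ u = 1 := fun u hu => by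
      have := hparity u hu
      exact Even.neg_one_pow (Nat.even_iff.mpr (by omega))
    refine coeff_mul_eInv_dvd_pos h4p (fun u _ hu => ?_) ?_
    · rw [coeff_signedTheta_one_one, heven u hu]
      linarith [coeff_squareTheta_nonneg u]
    · obtain ⟨r, hr, hrm⟩ := exists_le_of_signBound_lt h4p hn
        ⟨2 * t, by omega, by simpa only [show (2 * t) ^ 2 = 4 * t ^ 2 by ring] using hnt⟩
      refine ⟨_, hr, hrm, ?_⟩
      rw [coeff_signedTheta_one_one, heven _ hrm]
      linarith [coeff_squareTheta_pos r]
  · rintro ⟨hA, hB⟩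
    rw [h1]
    refine coeff_mul_eInv_dvd_eq_zero h4p fun u _ hu => ?_
    rw [coeff_signedTheta_one_one]
    by_contra hne
    obtain ⟨r, hr⟩ := exists_eq_sq_of_coeff_ne_zero (right_ne_zero_of_mul hne)
    rcases sq_modEq_odd_or_even hp0 (hr ▸ hu.symm : n ≡ r ^ 2 [MOD 4 * p]) with h | h
    · exact hA h
    · exact hB h
  · rw [← not_iff_not, ← exists_sq_modEq_iff hp, ← not_or, not_not]
    constructor
    · rintro (⟨t, -, ht⟩ | ⟨t, -, ht⟩)
      · exact ⟨2 * t + 1, by rwa [show (2 * t + 1) ^ 2 = 4 * t ^ 2 + 4 * t + 1 by ring]⟩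
      · exact ⟨2 * t, by rwa [show (2 * t) ^ 2 = 4 * t ^ 2 by ring]⟩
    · rintro ⟨r, hr⟩
      exact sq_modEq_odd_or_even hp0 hr

/-! ### Squares of theta series -/

theorem coeff_squareTheta_sq_nonneg (n : ℕ) : 0 ≤ coeff n (squareTheta ^ 2) :=
  NonnegCoeff.pow coeff_squareTheta_nonneg 2 n

/-- The sums `0 + 0`, `1 + 0`, `1 + 1` represent the smallest member of every class modulo `4`
except `3`, so positivity over `f₄` holds from `n = 0` on. -/
theorem coeff_squareTheta_sq_pos {n : ℕ} (hn : n < 3) : 0 < coeff n (squareTheta ^ 2) := by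
  have h0 : 0 < coeff 0 squareTheta := coeff_squareTheta_pos 0
  have h1 : 0 < coeff 1 squareTheta := coeff_squareTheta_pos 1
  rw [sq, coeff_mul]
  refine Finset.sum_pos'
    (fun x _ => mul_nonneg (coeff_squareTheta_nonneg _) (coeff_squareTheta_nonneg _)) ?_
  interval_cases n
  · exact ⟨(0, 0), by simp, mul_pos h0 h0⟩
  · exact ⟨(1, 0), by simp, mul_pos h1 h0⟩
  · exact ⟨(1, 1), by simp, mul_pos h1 h1⟩

theorem coeff_squareTheta_sq_eq_zero {n : ℕ} (hn : n % 4 = 3) :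
    coeff n (squareTheta ^ 2) = 0 := by
  have hsq : ∀ d, coeff d squareTheta ≠ 0 → d % 4 = 0 ∨ d % 4 = 1 := by
    intro d hd
    obtain ⟨r, rfl⟩ := exists_eq_sq_of_coeff_ne_zero hd
    have : r % 4 < 4 := Nat.mod_lt _ (by norm_num)
    rw [Nat.pow_mod]
    interval_cases r % 4 <;> simp
  rw [sq, coeff_mul]
  refine Finset.sum_eq_zero fun x hx => ?_
  rw [Finset.HasAntidiagonal.mem_antidiagonal] at hx
  by_contra hne
  have h1 := hsq _ (left_ne_zero_of_mul hne)
  have h2 := hsq _ (right_ne_zero_of_mul hne)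
  omega

theorem coeff_signedTheta_one_one_sq (n : ℕ) :
    coeff n (signedTheta 1 1 ^ 2) = (-1) ^ n * coeff n (squareTheta ^ 2) := by
  rw [sq, sq, coeff_mul, coeff_mul, Finset.mul_sum]
  refine Finset.sum_congr rfl fun x hx => ?_
  rw [Finset.HasAntidiagonal.mem_antidiagonal] at hx
  rw [coeff_signedTheta_one_one, coeff_signedTheta_one_one, ← hx, pow_add]
  ring

theorem sign_squareTheta_sq_quotient {a : ℕ → ℚ}
    (ha : qProd 2 ^ 10 * (qProd 1 ^ 4 * qProd 4 ^ 5)⁻¹ = PowerSeries.mk a) (n : ℕ) :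
    (n % 4 ∈ ({0, 1, 2} : Set ℕ) → 0 < a n) ∧ (n % 4 = 3 → a n = 0) := by
  have h1 : a n = coeff n (squareTheta ^ 2 * eInv (fun n => if 4 ∣ n then 1 else 0)) :=
    eq_mk_of_mul_eq ha
      (by simp [constantCoeff_qProd one_pos, constantCoeff_qProd four_pos])
      (by linear_combination squareTheta ^ 2 * qProd 1 ^ 4 * qProd 4 ^ 4 * qProd_mul_eInv four_pos
            + (squareTheta * (qProd 1 ^ 2 * qProd 4 ^ 2) + qProd 2 ^ 5) * squareTheta_mul) n
  rw [h1]
  constructor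
  · intro h
    simp only [Set.mem_insert_iff, Set.mem_singleton_iff] at h
    exact coeff_mul_eInv_dvd_pos four_pos (fun u _ _ => coeff_squareTheta_sq_nonneg u)
      ⟨n % 4, Nat.mod_le _ _, Nat.mod_modEq _ _, coeff_squareTheta_sq_pos (by omega)⟩
  · intro h
    exact coeff_mul_eInv_dvd_eq_zero four_pos fun u _ hu =>
      coeff_squareTheta_sq_eq_zero (hu.trans (show n ≡ 3 [MOD 4] from h))

theorem sign_signedTheta_sq_quotient {a : ℕ → ℚ}
    (ha : qProd 1 ^ 4 * (qProd 2 ^ 2 * qProd 4)⁻¹ = PowerSeries.mk a) (n : ℕ) :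
    (n % 4 ∈ ({0, 2} : Set ℕ) → 0 < a n) ∧ (n % 4 = 1 → a n < 0) ∧ (n % 4 = 3 → a n = 0) := by
  have h1 : a n = coeff n (signedTheta 1 1 ^ 2 * eInv (fun n => if 4 ∣ n then 1 else 0)) :=
    eq_mk_of_mul_eq ha
      (by simp [constantCoeff_qProd two_pos, constantCoeff_qProd four_pos])
      (by linear_combination signedTheta 1 1 ^ 2 * qProd 2 ^ 2 * qProd_mul_eInv four_pos
            + (signedTheta 1 1 * qProd 2 + qProd 1 ^ 2) * signedTheta_one_one_mul) n
  have hmod : ∀ u, u ≡ n [MOD 4] → u % 4 = n % 4 := fun u hu => hu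
  rw [h1]
  refine ⟨fun h => ?_, fun h => ?_, fun h => ?_⟩
  · simp only [Set.mem_insert_iff, Set.mem_singleton_iff] at h
    have heven : ∀ u, u ≡ n [MOD 4] → (-1 : ℚ) ^ u = 1 := fun u hu => by
      have := hmod u hu
      exact Even.neg_one_pow (Nat.even_iff.mpr (by omega))
    refine coeff_mul_eInv_dvd_pos four_pos (fun u _ hu => ?_)
      ⟨n % 4, Nat.mod_le _ _, Nat.mod_modEq _ _, ?_⟩
    · rw [coeff_signedTheta_one_one_sq, heven u hu, one_mul]
      exact coeff_squareTheta_sq_nonneg u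
    · rw [coeff_signedTheta_one_one_sq, heven _ (Nat.mod_modEq _ _), one_mul]
      exact coeff_squareTheta_sq_pos (by omega)
  · have hodd : ∀ u, u ≡ n [MOD 4] → (-1 : ℚ) ^ u = -1 := fun u hu => by
      have := hmod u hu
      exact Odd.neg_one_pow (Nat.odd_iff.mpr (by omega))
    refine coeff_mul_eInv_dvd_neg four_pos (fun u _ hu => ?_)
      ⟨n % 4, Nat.mod_le _ _, Nat.mod_modEq _ _, ?_⟩
    · rw [coeff_signedTheta_one_one_sq, hodd u hu]
      linarith [coeff_squareTheta_sq_nonneg u]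
    · rw [coeff_signedTheta_one_one_sq, hodd _ (Nat.mod_modEq _ _)]
      linarith [coeff_squareTheta_sq_pos (n := n % 4) (by omega)]
  · refine coeff_mul_eInv_dvd_eq_zero four_pos fun u _ hu => ?_
    rw [coeff_signedTheta_one_one_sq, coeff_squareTheta_sq_eq_zero (hu.trans (show n ≡ 3 [MOD 4] from h)), mul_zero]

/-! ### Positivity of quotients of eta products -/

theorem PosCoeff.mul_pos {F G : ℚ⟦X⟧} (hF : PosCoeff F) (hG : PosCoeff G) : PosCoeff (F * G) :=
  hF.mul hG.nonneg hG.constantCoeff_pos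

theorem eProd_mul_eInv_of_le {c c' : ℕ → ℕ} (h : ∀ n, 0 < n → c n ≤ c' n) :
    eProd c * eInv c' = eInv (fun n => c' n - c n) :=
  eProd_mul_eInv fun n hn => Nat.add_sub_cancel' (h n hn)

theorem posCoeff_eProd_mul_eInv {c c' : ℕ → ℕ} (h : ∀ n, 0 < n → c n ≤ c' n) (h1 : c 1 < c' 1) :
    PosCoeff (eProd c * eInv c') := by
  rw [eProd_mul_eInv_of_le h]
  exact posCoeff_eInv (by omega)

theorem nonnegCoeff_eProd_mul_eInv {c c' : ℕ → ℕ} (h : ∀ n, 0 < n → c n ≤ c' n) :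
    NonnegCoeff (eProd c * eInv c') := by
  rw [eProd_mul_eInv_of_le h]
  exact nonnegCoeff_eInv _

theorem eProd_pow (c : ℕ → ℕ) (k : ℕ) : eProd c ^ k = eProd (fun n => k * c n) := by
  induction k with
  | zero =>
    rw [pow_zero, eProd]
    exact ((tprod_congr fun n => by rw [zero_mul, pow_zero]).trans tprod_one).symm
  | succ k ih =>
    rw [pow_succ, ih, ← eProd_add]
    exact eProd_congr fun n _ => by ring

theorem eInv_pow (c : ℕ → ℕ) (k : ℕ) : eInv c ^ k = eInv (fun n => k * c n) := by
  induction k with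
  | zero =>
    rw [pow_zero, eInv]
    exact ((tprod_congr fun n => by rw [zero_mul, pow_zero]).trans tprod_one).symm
  | succ k ih =>
    rw [pow_succ, ih, ← eInv_add]
    exact eInv_congr fun n _ => by ring

/-- The generating function of the partition numbers, the inverse of `qProd 1`. -/
noncomputable def partSeries : ℚ⟦X⟧ := eInv fun _ => 1

theorem partSeries_pow (k : ℕ) : partSeries ^ k = eInv (fun _ => k) := by
  rw [partSeries, eInv_pow]
  simp_rw [mul_one]

theorem qProd_mul_expand_partSeries {k : ℕ} (hk : k ≠ 0) :
    qProd k * expand k hk partSeries = 1 := by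
  rw [partSeries, ← eInv_dvd_eq_expand (Nat.pos_of_ne_zero hk),
    qProd_mul_eInv (Nat.pos_of_ne_zero hk)]

theorem qProd_one_mul_partSeries : qProd 1 * partSeries = 1 := by
  rw [qProd_one_eq_eProd, partSeries, eProd_mul_eInv_self]

theorem posCoeff_partSeries_pow {k : ℕ} (hk : 0 < k) : PosCoeff (partSeries ^ k) := by
  rw [partSeries_pow]
  exact posCoeff_eInv hk

theorem posCoeff_qProd_three_pow_mul {k l : ℕ} (h : k ≤ l) (hl : 0 < l) :
    PosCoeff (qProd 3 ^ k * partSeries ^ l) := by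
  rw [qProd_eq_eProd (by norm_num), eProd_pow, partSeries_pow]
  refine posCoeff_eProd_mul_eInv (fun n _ => ?_) ?_
  · split_ifs <;> omega
  · simpa using hl

theorem signedTheta_exponent_le {i j : ℕ} (hi : 0 < i) (hj : 0 < j) (hij : i ≠ j) (n : ℕ) :
    (if (i + j) ∣ n then 1 else 0) + ((if n % (i + j) = i % (i + j) then 1 else 0) +
      (if n % (i + j) = j % (i + j) then 1 else 0)) ≤ 1 := by
  simp only [Nat.mod_eq_of_lt (show i < i + j by omega),
    Nat.mod_eq_of_lt (show j < i + j by omega), Nat.dvd_iff_mod_eq_zero]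
  split_ifs <;> omega

/-- For `i ≠ j` the three residue classes in the product are disjoint, so no exponent exceeds `1`.
One power of `partSeries` absorbs them, and a second one gives strict positivity. -/
theorem posCoeff_signedTheta_mul {i j k : ℕ} (hi : 0 < i) (hj : 0 < j) (hij : i ≠ j)
    (hk : 2 ≤ k) : PosCoeff (signedTheta i j * partSeries ^ k) := by
  rw [signedTheta_eq_eProd hi hj, partSeries_pow]
  exact posCoeff_eProd_mul_eInv
    (fun n _ => (signedTheta_exponent_le hi hj hij n).trans (by omega))
    ((signedTheta_exponent_le hi hj hij 1).trans_lt (by omega))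

theorem nonnegCoeff_signedTheta_mul {i j : ℕ} (hi : 0 < i) (hj : 0 < j) (hij : i ≠ j) :
    NonnegCoeff (signedTheta i j * partSeries) := by
  rw [signedTheta_eq_eProd hi hj, partSeries]
  exact nonnegCoeff_eProd_mul_eInv fun n _ => signedTheta_exponent_le hi hj hij n

theorem coeff_dissection_mul {m : ℕ} (hm : m ≠ 0) (A : ℕ → ℚ⟦X⟧) (V : ℚ⟦X⟧) (n : ℕ) :
    coeff n ((∑ j ∈ Finset.range m, X ^ j * expand m hm (A j)) * expand m hm V)
      = coeff (n / m) (A (n % m) * V) := by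
  rw [Finset.sum_mul, ← coeff_dissection hm (fun j => A j * V)]
  simp_rw [map_mul, mul_assoc]

theorem coeff_three_dissection_mul (A B D V : ℚ⟦X⟧) (n : ℕ) :
    coeff n ((expand 3 (by norm_num) A + X * expand 3 (by norm_num) B
        + X ^ 2 * expand 3 (by norm_num) D) * expand 3 (by norm_num) V)
      = coeff (n / 3) ((if n % 3 = 0 then A else if n % 3 = 1 then B else D) * V) := by
  rw [← coeff_dissection_mul (m := 3) (by norm_num)
    (fun j => if j = 0 then A else if j = 1 then B else D)]
  simp [Finset.sum_range_succ]

/-! ### Positivity of `f₃ ^ 3 / f₁ ^ 2` -/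

theorem X_pow_dvd_eProd_sub_one {c : ℕ → ℕ} {N : ℕ} (hc : ∀ n < N, c n = 0) :
    X ^ N ∣ eProd c - 1 := by
  refine X_pow_dvd_of_tendsto ((tendsto_tprod (multipliable_eProd c)).sub_const 1) fun m => ?_
  induction m with
  | zero => simp
  | succ m ih =>
    rw [Finset.prod_range_succ]
    have h1 : (X : ℚ⟦X⟧) ^ N ∣ (1 - X ^ (m + 1)) ^ c (m + 1) - 1 := by
      by_cases hm : m + 1 < N
      · rw [hc _ hm, pow_zero, sub_self]
        exact dvd_zero _
      · have h := sub_dvd_pow_sub_pow (1 - X ^ (m + 1) : ℚ⟦X⟧) 1 (c (m + 1))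
        rw [one_pow] at h
        refine dvd_trans ?_ h
        rw [sub_sub_cancel_left, dvd_neg]
        exact pow_dvd_pow _ (by omega)
    have h2 := dvd_add (ih.mul_right ((1 - X ^ (m + 1)) ^ c (m + 1))) h1
    convert h2 using 1
    ring

theorem coeff_mul_of_X_pow_dvd {W E : ℚ⟦X⟧} {d N : ℕ} (hd : d < N) (h : X ^ N ∣ E - 1) :
    coeff d (W * E) = coeff d W := by
  have := X_pow_dvd_iff.mp (h.mul_left W) d hd
  rwa [mul_sub, mul_one, map_sub, sub_eq_zero] at this

/-- With `x = X ^ i` and `y = X ^ j`, this rests on `1 - x y = (1 - y) + y (1 - x)`; a numerator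
factor paired with two denominator factors is nonnegative. -/
theorem one_sub_mul_mul_inv_mul_inv {i j : ℕ} (hi : 0 < i) (hj : 0 < j) :
    (1 - X ^ (i + j) : ℚ⟦X⟧) * ((1 - X ^ i)⁻¹ * (1 - X ^ j)⁻¹)
      = (1 - X ^ i)⁻¹ + X ^ j * (1 - X ^ j)⁻¹ := by
  have h1 := one_sub_X_pow_mul_inv hi
  have h2 := one_sub_X_pow_mul_inv hj
  rw [pow_add]
  linear_combination X ^ j * (1 - X ^ j)⁻¹ * h1 + (1 - X ^ i)⁻¹ * h2

theorem nonnegCoeff_one_sub_mul_mul_inv_mul_inv {i j : ℕ} (hi : 0 < i) (hj : 0 < j) :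
    NonnegCoeff ((1 - X ^ (i + j) : ℚ⟦X⟧) * ((1 - X ^ i)⁻¹ * (1 - X ^ j)⁻¹)) := by
  rw [one_sub_mul_mul_inv_mul_inv hi hj]
  exact (nonnegCoeff_one_sub_X_pow_inv hi).add
    ((nonnegCoeff_X_pow j).mul (nonnegCoeff_one_sub_X_pow_inv hj))

theorem posCoeff_one_sub_mul_mul_inv_mul_inv {j : ℕ} (hj : 0 < j) :
    PosCoeff ((1 - X ^ (1 + j) : ℚ⟦X⟧) * ((1 - X ^ 1)⁻¹ * (1 - X ^ j)⁻¹)) := by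
  rw [one_sub_mul_mul_inv_mul_inv one_pos hj, pow_one]
  exact posCoeff_one_sub_X_inv.add ((nonnegCoeff_X_pow j).mul (nonnegCoeff_one_sub_X_pow_inv hj))

/-- Pairing each factor of the numerator of `f₃ ^ 3 / f₁ ^ 2` with two factors of the
denominator. -/
noncomputable def pairedFactor (k : ℕ) : ℚ⟦X⟧ :=
  (1 - X ^ ((3 * k + 1) + (3 * k + 2))) * ((1 - X ^ (3 * k + 1))⁻¹ * (1 - X ^ (3 * k + 2))⁻¹) *
  ((1 - X ^ ((3 * k + 1) + (3 * k + 5))) * ((1 - X ^ (3 * k + 1))⁻¹ * (1 - X ^ (3 * k + 5))⁻¹))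

theorem nonnegCoeff_pairedFactor (k : ℕ) : NonnegCoeff (pairedFactor k) :=
  (nonnegCoeff_one_sub_mul_mul_inv_mul_inv (by omega) (by omega)).mul
    (nonnegCoeff_one_sub_mul_mul_inv_mul_inv (by omega) (by omega))

theorem constantCoeff_pairedFactor (k : ℕ) : constantCoeff (pairedFactor k) = 1 := by
  simp [pairedFactor]

theorem posCoeff_prod_pairedFactor (m : ℕ) :
    PosCoeff (∏ k ∈ Finset.range (m + 1), pairedFactor k) := by
  rw [Finset.prod_range_succ', mul_comm]
  refine PosCoeff.mul ?_ (nonnegCoeff_prod _ fun k _ => nonnegCoeff_pairedFactor _) ?_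
  · exact (posCoeff_one_sub_mul_mul_inv_mul_inv two_pos).mul_pos
      (posCoeff_one_sub_mul_mul_inv_mul_inv (show 0 < 5 by norm_num))
  · rw [map_prod]
    simp [constantCoeff_pairedFactor]

/-- The numerator exponents are `6k + 3 = (3k+1) + (3k+2)` and `6k + 6 = (3k+1) + (3k+5)`, covering
each multiple of `3` once. Every `3k + 1` is used twice; members of the class `2` are used once by
each kind of pair, except that `2` itself never occurs as `3k + 5`. -/
theorem prod_pairedFactor (m : ℕ) :
    ∏ k ∈ Finset.range m, pairedFactor k =
      eProd (fun n => if 3 ∣ n ∧ n ≤ 6 * m then 1 else 0) *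
      eInv (fun n => (if n % 3 = 1 ∧ n ≤ 3 * m then 2 else 0) +
        ((if n % 3 = 2 ∧ n ≤ 3 * m then 1 else 0) +
          (if n % 3 = 2 ∧ 5 ≤ n ∧ n ≤ 3 * m + 2 then 1 else 0))) := by
  induction m with
  | zero =>
    rw [Finset.prod_range_zero, eProd, eInv]
    have h1 : ∀ n : ℕ, (1 - X ^ (n + 1) : ℚ⟦X⟧) ^ (if 3 ∣ n + 1 ∧ n + 1 ≤ 6 * 0 then 1 else 0)
        = 1 := fun n => by rw [if_neg (by omega), pow_zero]
    have h2 : ∀ n : ℕ, ((1 - X ^ (n + 1) : ℚ⟦X⟧)⁻¹) ^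
        ((if (n + 1) % 3 = 1 ∧ n + 1 ≤ 3 * 0 then 2 else 0) +
        ((if (n + 1) % 3 = 2 ∧ n + 1 ≤ 3 * 0 then 1 else 0) +
          (if (n + 1) % 3 = 2 ∧ 5 ≤ n + 1 ∧ n + 1 ≤ 3 * 0 + 2 then 1 else 0))) = 1 := fun n => by
      rw [if_neg (by omega), if_neg (by omega), if_neg (by omega), pow_zero]
    simp_rw [h1, h2, tprod_one, mul_one]
  | succ m ih =>
    rw [Finset.prod_range_succ, ih, pairedFactor]
    have e1 := eInv_single (3 * m + 1) (by omega)
    have e2 := eInv_single (3 * m + 2) (by omega)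
    have e5 := eInv_single (3 * m + 5) (by omega)
    have n3 := eProd_single ((3 * m + 1) + (3 * m + 2)) (by omega)
    have n6 := eProd_single ((3 * m + 1) + (3 * m + 5)) (by omega)
    rw [← e1, ← e2, ← e5, ← n3, ← n6]
    have hE : eProd (fun n => if 3 ∣ n ∧ n ≤ 6 * (m + 1) then 1 else 0)
        = eProd (fun n => if 3 ∣ n ∧ n ≤ 6 * m then 1 else 0)
          * (eProd (fun n => if n = (3 * m + 1) + (3 * m + 2) then 1 else 0)
            * eProd (fun n => if n = (3 * m + 1) + (3 * m + 5) then 1 else 0)) := by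
      rw [← eProd_add, ← eProd_add]
      refine eProd_congr fun n hn => ?_
      split_ifs <;> omega
    have hI : eInv (fun n => (if n % 3 = 1 ∧ n ≤ 3 * (m + 1) then 2 else 0) +
          ((if n % 3 = 2 ∧ n ≤ 3 * (m + 1) then 1 else 0) +
            (if n % 3 = 2 ∧ 5 ≤ n ∧ n ≤ 3 * (m + 1) + 2 then 1 else 0)))
        = eInv (fun n => (if n % 3 = 1 ∧ n ≤ 3 * m then 2 else 0) +
          ((if n % 3 = 2 ∧ n ≤ 3 * m then 1 else 0) +
            (if n % 3 = 2 ∧ 5 ≤ n ∧ n ≤ 3 * m + 2 then 1 else 0)))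
          * (eInv (fun n => if n = 3 * m + 1 then 1 else 0)
            * eInv (fun n => if n = 3 * m + 1 then 1 else 0)
            * (eInv (fun n => if n = 3 * m + 2 then 1 else 0)
              * eInv (fun n => if n = 3 * m + 5 then 1 else 0))) := by
      rw [← eInv_add, ← eInv_add, ← eInv_add, ← eInv_add]
      refine eInv_congr fun n hn => ?_
      have h1 : (if n % 3 = 1 ∧ n ≤ 3 * (m + 1) then 2 else 0)
          = (if n % 3 = 1 ∧ n ≤ 3 * m then 2 else 0) + ((if n = 3 * m + 1 then 1 else 0)
            + (if n = 3 * m + 1 then 1 else 0)) := by split_ifs <;> omega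
      have h2 : (if n % 3 = 2 ∧ n ≤ 3 * (m + 1) then 1 else 0)
          = (if n % 3 = 2 ∧ n ≤ 3 * m then 1 else 0) + (if n = 3 * m + 2 then 1 else 0) := by
        split_ifs <;> omega
      have h3 : (if n % 3 = 2 ∧ 5 ≤ n ∧ n ≤ 3 * (m + 1) + 2 then 1 else 0)
          = (if n % 3 = 2 ∧ 5 ≤ n ∧ n ≤ 3 * m + 2 then 1 else 0)
            + (if n = 3 * m + 5 then 1 else 0) := by
        split_ifs <;> omega
      rw [h1, h2, h3]
      ring
    rw [hE, hI]
    ring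

/-- `f₃² / f₁²` has the factors `(1 - X ^ n)⁻²` with `3 ∤ n`. This leaves enough denominators to
pair off the remaining `f₃`; for the coefficient at `d` finitely many pairs suffice, as the unpaired
numerator factors start beyond `d`. -/
theorem posCoeff_qProd_three_cube_mul : PosCoeff (qProd 3 ^ 3 * partSeries ^ 2) := by
  intro d
  have hZ : qProd 3 ^ 3 * partSeries ^ 2 = (∏ k ∈ Finset.range (d + 1), pairedFactor k) *
      eInv (fun n => (if 3 ∣ n then 0 else 2) - ((if n % 3 = 1 ∧ n ≤ 3 * (d + 1) then 2 else 0) +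
        ((if n % 3 = 2 ∧ n ≤ 3 * (d + 1) then 1 else 0) +
          (if n % 3 = 2 ∧ 5 ≤ n ∧ n ≤ 3 * (d + 1) + 2 then 1 else 0)))) *
      eProd (fun n => if 3 ∣ n ∧ 6 * (d + 1) < n then 1 else 0) := by
    have h1 : qProd 3 ^ 2 * partSeries ^ 2 = eInv (fun n => if 3 ∣ n then 0 else 2) := by
      rw [qProd_eq_eProd (by norm_num), eProd_pow, partSeries_pow]
      refine eProd_mul_eInv fun n _ => ?_
      split_ifs <;> omega
    have h2 : qProd 3 = eProd (fun n => if 3 ∣ n ∧ n ≤ 6 * (d + 1) then 1 else 0)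
        * eProd (fun n => if 3 ∣ n ∧ 6 * (d + 1) < n then 1 else 0) := by
      rw [qProd_eq_eProd (by norm_num), ← eProd_add]
      refine eProd_congr fun n _ => ?_
      split_ifs <;> omega
    have h3 : eInv (fun n => if 3 ∣ n then 0 else 2)
        = eInv (fun n => (if n % 3 = 1 ∧ n ≤ 3 * (d + 1) then 2 else 0) +
          ((if n % 3 = 2 ∧ n ≤ 3 * (d + 1) then 1 else 0) +
            (if n % 3 = 2 ∧ 5 ≤ n ∧ n ≤ 3 * (d + 1) + 2 then 1 else 0))) *
          eInv (fun n => (if 3 ∣ n then 0 else 2) -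
            ((if n % 3 = 1 ∧ n ≤ 3 * (d + 1) then 2 else 0) +
            ((if n % 3 = 2 ∧ n ≤ 3 * (d + 1) then 1 else 0) +
            (if n % 3 = 2 ∧ 5 ≤ n ∧ n ≤ 3 * (d + 1) + 2 then 1 else 0)))) := by
      rw [← eInv_add]
      refine eInv_congr fun n _ => ?_
      have hle : ((if n % 3 = 1 ∧ n ≤ 3 * (d + 1) then 2 else 0) +
            ((if n % 3 = 2 ∧ n ≤ 3 * (d + 1) then 1 else 0) +
            (if n % 3 = 2 ∧ 5 ≤ n ∧ n ≤ 3 * (d + 1) + 2 then 1 else 0)))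
          ≤ (if 3 ∣ n then 0 else 2) := by
        split_ifs <;> omega
      exact (Nat.add_sub_cancel' hle).symm
    rw [show qProd 3 ^ 3 * partSeries ^ 2 = qProd 3 * (qProd 3 ^ 2 * partSeries ^ 2) by ring,
      h1, h3, prod_pairedFactor, h2]
    ring
  have hpos := (posCoeff_prod_pairedFactor d).mul (nonnegCoeff_eInv
    (fun n => (if 3 ∣ n then 0 else 2) - ((if n % 3 = 1 ∧ n ≤ 3 * (d + 1) then 2 else 0) +
        ((if n % 3 = 2 ∧ n ≤ 3 * (d + 1) then 1 else 0) +
          (if n % 3 = 2 ∧ 5 ≤ n ∧ n ≤ 3 * (d + 1) + 2 then 1 else 0)))))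
    (by rw [constantCoeff_eInv]; norm_num)
  rw [hZ, coeff_mul_of_X_pow_dvd (Nat.lt_succ_self d)
    (X_pow_dvd_eProd_sub_one fun n hn => if_neg (by omega))]
  exact hpos d

/-! ### Quotients by powers of `f₃` -/

/-- Turns division by a power of `f_p` into multiplication by a series in `X ^ p`, which acts on
each component of a dissection separately. -/
theorem quotient_eq_expand {N : ℚ⟦X⟧} {a : ℕ → ℚ} {p i : ℕ} (hp : p ≠ 0)
    (h : N * (qProd p ^ i)⁻¹ = mk a) (n : ℕ) :
    a n = coeff n (N * expand p hp (partSeries ^ i)) := by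
  refine eq_mk_of_mul_eq h ?_ ?_ n
  · rw [map_pow, constantCoeff_qProd (Nat.pos_of_ne_zero hp), one_pow]
  · rw [map_pow, mul_assoc, ← mul_pow, mul_comm (expand p hp partSeries),
      qProd_mul_expand_partSeries, one_pow, mul_one]

theorem coeff_neg_of_posCoeff {F G : ℚ⟦X⟧} {c : ℚ} (hc : c < 0) (hG : PosCoeff G)
    (h : F = C c * G) (n : ℕ) : coeff n F < 0 := by
  rw [h, coeff_C_mul]
  exact mul_neg_of_neg_of_pos hc (hG n)

theorem sign_cube_quotient {a : ℕ → ℚ} (ha : qProd 1 ^ 3 * (qProd 3 ^ 2)⁻¹ = PowerSeries.mk a)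
    (n : ℕ) :
    (n % 3 = 0 → 0 < a n) ∧ (n % 3 = 1 → a n < 0) ∧ (n % 3 = 2 → a n = 0) := by
  obtain ⟨P, hP, hP2⟩ := cube_dissection
  have h1 := quotient_eq_expand (by norm_num) ha n
  have h2 : qProd 1 ^ 3 = expand 3 (by norm_num) P
      + X * expand 3 (by norm_num) (C (-3) * qProd 3 ^ 3) + X ^ 2 * expand 3 (by norm_num) 0 := by
    rw [hP, map_mul, expand_C, map_neg, show (C (3 : ℚ) : ℚ⟦X⟧) = 3 from map_ofNat C 3, map_zero]
    ring
  rw [h2, coeff_three_dissection_mul] at h1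
  rw [h1]
  refine ⟨fun h => ?_, fun h => ?_, fun h => ?_⟩
  · rw [if_pos h, partSeries_pow]
    exact hP2 _
  · rw [if_neg (by omega), if_pos h]
    exact coeff_neg_of_posCoeff (by norm_num) posCoeff_qProd_three_cube_mul (mul_assoc _ _ _) _
  · rw [if_neg (by omega), if_neg (by omega), zero_mul, map_zero]

theorem sign_signedTheta_quotient {a : ℕ → ℚ}
    (ha : qProd 1 ^ 2 * (qProd 2 * qProd 3 ^ 2)⁻¹ = PowerSeries.mk a) (n : ℕ) :
    (n % 3 = 0 → 0 < a n) ∧ (n % 3 = 1 → a n < 0) ∧ (n % 3 = 2 → a n = 0) := by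
  have h0 : signedTheta 1 1 * (qProd 3 ^ 2)⁻¹ = mk a := by
    rw [← ha, PowerSeries.mul_inv_rev, ← signedTheta_one_one_mul]
    have := PowerSeries.mul_inv_cancel (qProd 2) (by simp [constantCoeff_qProd two_pos])
    linear_combination (-signedTheta 1 1 * (qProd 3 ^ 2)⁻¹) * this
  have h1 := quotient_eq_expand (by norm_num) h0 n
  have h2 : signedTheta 1 1 = expand 3 (by norm_num) (signedTheta 3 3)
      + X * expand 3 (by norm_num) (C (-2) * signedTheta 1 5)
      + X ^ 2 * expand 3 (by norm_num) 0 := by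
    rw [signedTheta_one_one_dissection, map_mul, expand_C, map_neg,
      show (C (2 : ℚ) : ℚ⟦X⟧) = 2 from map_ofNat C 2, map_zero]
    ring
  rw [h2, coeff_three_dissection_mul] at h1
  rw [h1]
  refine ⟨fun h => ?_, fun h => ?_, fun h => ?_⟩
  · rw [if_pos h, signedTheta_eq_eProd (by norm_num) (by norm_num), partSeries_pow]
    refine posCoeff_eProd_mul_eInv (fun n _ => ?_) (by norm_num) _
    split_ifs <;> omega
  · rw [if_neg (by omega), if_pos h]
    exact coeff_neg_of_posCoeff (by norm_num)
      (posCoeff_signedTheta_mul (by norm_num) (by norm_num) (by norm_num) le_rfl)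
      (mul_assoc _ _ _) _
  · rw [if_neg (by omega), if_neg (by omega), zero_mul, map_zero]

/-! ### The norm with respect to the 3-dissection -/

/-- The series formed by the coefficients in the residue class of `j` modulo `m`. -/
noncomputable def dissect (m j : ℕ) (F : ℚ⟦X⟧) : ℚ⟦X⟧ := mk fun n => coeff (m * n + j) F

theorem continuous_dissect (m j : ℕ) : Continuous (dissect m j) := by
  rw [continuous_iff_continuousAt]
  intro F
  refine (PowerSeries.WithPiTopology.tendsto_iff_coeff_tendsto ℚ _ _ _).mpr fun d => ?_
  simp_rw [dissect, coeff_mk]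
  exact (PowerSeries.WithPiTopology.continuous_coeff ℚ _).tendsto F

theorem dissect_sum {m : ℕ} (hm : m ≠ 0) (A : ℕ → ℚ⟦X⟧) {j : ℕ} (hj : j < m) :
    dissect m j (∑ j ∈ Finset.range m, X ^ j * expand m hm (A j)) = A j := by
  ext n
  rw [dissect, coeff_mk, coeff_dissection, Nat.mul_add_mod, Nat.mod_eq_of_lt hj,
    Nat.mul_add_div (Nat.pos_of_ne_zero hm), Nat.div_eq_of_lt hj, add_zero]

theorem sum_dissect {m : ℕ} (hm : m ≠ 0) (F : ℚ⟦X⟧) :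
    ∑ j ∈ Finset.range m, X ^ j * expand m hm (dissect m j F) = F := by
  ext n
  rw [coeff_dissection, dissect, coeff_mk, Nat.div_add_mod]

theorem dissect_three {F A B D : ℚ⟦X⟧} (h : F = expand 3 (by norm_num) A
      + X * expand 3 (by norm_num) B + X ^ 2 * expand 3 (by norm_num) D) :
    dissect 3 0 F = A ∧ dissect 3 1 F = B ∧ dissect 3 2 F = D := by
  have h1 : F = ∑ j ∈ Finset.range 3, X ^ j * expand 3 (by norm_num)
      ((fun j : ℕ => if j = 0 then A else if j = 1 then B else D) j) := by
    rw [h]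
    simp [Finset.sum_range_succ]
  rw [h1]
  exact ⟨dissect_sum _ _ (by norm_num), dissect_sum _ _ (by norm_num),
    dissect_sum _ _ (by norm_num)⟩

theorem eq_three_dissection (F : ℚ⟦X⟧) : F = expand 3 (by norm_num) (dissect 3 0 F)
    + X * expand 3 (by norm_num) (dissect 3 1 F)
    + X ^ 2 * expand 3 (by norm_num) (dissect 3 2 F) := by
  conv_lhs => rw [← sum_dissect (m := 3) (by norm_num) F]
  simp [Finset.sum_range_succ]

/-- The norm from power series in `X` to power series in `X ^ 3`. -/
noncomputable def cubicNorm : ℚ⟦X⟧ →* ℚ⟦X⟧ where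
  toFun F := dissect 3 0 F ^ 3 + X * dissect 3 1 F ^ 3 + X ^ 2 * dissect 3 2 F ^ 3
    - 3 * X * dissect 3 0 F * dissect 3 1 F * dissect 3 2 F
  map_one' := by
    obtain ⟨h0, h1, h2⟩ := dissect_three (F := 1) (A := 1) (B := 0) (D := 0) (by simp)
    rw [h0, h1, h2]
    ring
  -- The formula is the determinant of multiplication by `F` on the basis `1, X, X²` over series in
  -- `X³`, equivalently the product of `F(ω X)` over the cube roots of unity; multiplicativity is
  -- then a polynomial identity in the components.
  map_mul' F G := by
    have hF := eq_three_dissection F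
    have hG := eq_three_dissection G
    generalize dissect 3 0 F = A at *
    generalize dissect 3 1 F = B at *
    generalize dissect 3 2 F = D at *
    generalize dissect 3 0 G = A' at *
    generalize dissect 3 1 G = B' at *
    generalize dissect 3 2 G = D' at *
    obtain ⟨h0, h1, h2⟩ := dissect_three (F := F * G) (A := A * A' + X * (B * D' + D * B'))
      (B := A * B' + B * A' + X * (D * D')) (D := A * D' + B * B' + D * A') (by
        rw [hF, hG]
        simp only [map_add, map_mul, expand_X]
        ring)
    rw [h0, h1, h2]
    ring

theorem cubicNorm_apply {F A B D : ℚ⟦X⟧} (h : F = expand 3 (by norm_num) A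
      + X * expand 3 (by norm_num) B + X ^ 2 * expand 3 (by norm_num) D) :
    cubicNorm F = A ^ 3 + X * B ^ 3 + X ^ 2 * D ^ 3 - 3 * X * A * B * D := by
  obtain ⟨h0, h1, h2⟩ := dissect_three h
  rw [← h0, ← h1, ← h2]
  rfl

theorem continuous_cubicNorm : Continuous cubicNorm := by
  have h0 := continuous_dissect 3 0
  have h1 := continuous_dissect 3 1
  have h2 := continuous_dissect 3 2
  change Continuous fun F => dissect 3 0 F ^ 3 + X * dissect 3 1 F ^ 3 + X ^ 2 * dissect 3 2 F ^ 3
    - 3 * X * dissect 3 0 F * dissect 3 1 F * dissect 3 2 F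
  fun_prop

theorem cubicNorm_one_sub_X_pow (m : ℕ) :
    cubicNorm (1 - X ^ m) = if 3 ∣ m then (1 - X ^ (m / 3)) ^ 3 else 1 - X ^ m := by
  have hm := Nat.div_add_mod m 3
  have hlt := Nat.mod_lt m (show 0 < 3 by norm_num)
  generalize m / 3 = t at *
  have hcases : m = 3 * t ∨ m = 3 * t + 1 ∨ m = 3 * t + 2 := by omega
  rcases hcases with rfl | rfl | rfl
  · rw [cubicNorm_apply (A := 1 - X ^ t) (B := 0) (D := 0), if_pos (dvd_mul_right 3 t)]
    · ring
    · simp [← pow_mul]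
  · rw [cubicNorm_apply (A := 1) (B := -X ^ t) (D := 0), if_neg (by omega)]
    · ring
    · simp [← pow_mul]
      ring
  · rw [cubicNorm_apply (A := 1) (B := 0) (D := -X ^ t), if_neg (by omega)]
    · ring
    · simp [← pow_mul]
      ring

/-- By continuity the norm is taken factor by factor. Factors with `3 ∣ m` become `(1 - X ^ (m / 3))
^ 3` and together give `f₁³`; the others are fixed and give `f₁ / f₃`. -/
theorem cubicNorm_qProd_one : cubicNorm (qProd 1) * qProd 3 = qProd 1 ^ 4 := by
  have h1 : cubicNorm (qProd 1) = qProd 1 ^ 3 * eProd (fun n => if 3 ∣ n then 0 else 1) := by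
    -- The index `n` stands for the exponent `n + 1`, so `3 n + 2` enumerates the exponents
    -- divisible by `3`.
    have hinj : Function.Injective fun n : ℕ => 3 * n + 2 := fun a b hab => by
      have : 3 * a + 2 = 3 * b + 2 := hab
      omega
    have hcomp : ∀ n : ℕ, (1 - X ^ (n + 1) : ℚ⟦X⟧) ^ 3 =
        if 3 ∣ 3 * n + 2 + 1 then (1 - X ^ ((3 * n + 2 + 1) / 3)) ^ 3 else 1 := fun n => by
      rw [if_pos (by omega), show (3 * n + 2 + 1) / 3 = n + 1 by omega]
    have hrange : ∀ n ∉ Set.range fun n : ℕ => 3 * n + 2, ¬ 3 ∣ n + 1 :=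
      fun n hn hd => hn ⟨n / 3, by simp only; omega⟩
    have hmul : Multipliable fun n : ℕ =>
        (if 3 ∣ n + 1 then (1 - X ^ ((n + 1) / 3)) ^ 3 else 1 : ℚ⟦X⟧) :=
      (hinj.multipliable_iff fun n hn => if_neg (hrange n hn)).mp
        ((multipliable_eProd fun _ => 3).congr fun n => hcomp n)
    have hcube : qProd 1 ^ 3 = ∏' n : ℕ,
        (if 3 ∣ n + 1 then (1 - X ^ ((n + 1) / 3)) ^ 3 else 1 : ℚ⟦X⟧) := by
      have h := hinj.tprod_eq (f := fun n : ℕ =>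
        (if 3 ∣ n + 1 then (1 - X ^ ((n + 1) / 3)) ^ 3 else 1 : ℚ⟦X⟧)) fun n hn => by
          by_contra hr
          exact hn (if_neg (hrange n hr))
      rw [← h, qProd_one_eq_eProd, eProd_pow, eProd]
      exact tprod_congr fun n => by rw [← hcomp n]
    have hq := multipliable_qProd one_pos
    rw [hcube, qProd, hq.map_tprod cubicNorm continuous_cubicNorm, eProd,
      ← hmul.tprod_mul (multipliable_eProd fun n => if 3 ∣ n then 0 else 1)]
    refine tprod_congr fun n => ?_
    rw [one_mul, cubicNorm_one_sub_X_pow]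
    split_ifs <;> simp
  rw [h1, mul_assoc, qProd_eq_eProd (show 0 < 3 by norm_num), ← eProd_add, pow_succ (qProd 1) 3]
  congr 1
  rw [qProd_one_eq_eProd]
  refine eProd_congr fun n _ => ?_
  split_ifs <;> rfl

/-- The 3-dissection of `f₁ ^ 9`. -/
theorem ninth_power_dissection : ∃ P B : ℚ⟦X⟧,
    qProd 1 ^ 3 = expand 3 (by norm_num) P + X * expand 3 (by norm_num) (C (-3) * qProd 3 ^ 3)
      + X ^ 2 * expand 3 (by norm_num) 0 ∧
    qProd 1 ^ 9 = expand 3 (by norm_num) B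
      + X * expand 3 (by norm_num) (C (-9) * (P ^ 2 * qProd 3 ^ 3))
      + X ^ 2 * expand 3 (by norm_num) (C 27 * (P * qProd 3 ^ 6)) ∧
    B * qProd 3 ^ 3 = qProd 1 ^ 12 ∧ PosCoeff (P * partSeries ^ 2) := by
  obtain ⟨P, hP, hP2⟩ := cube_dissection
  rw [← partSeries_pow] at hP2
  have h3 : (C (3 : ℚ) : ℚ⟦X⟧) = 3 := map_ofNat C 3
  have hcube : qProd 1 ^ 3 = expand 3 (by norm_num) P
      + X * expand 3 (by norm_num) (C (-3) * qProd 3 ^ 3) + X ^ 2 * expand 3 (by norm_num) 0 := by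
    rw [hP, map_mul, expand_C, map_neg, h3, map_zero]
    ring
  refine ⟨P, P ^ 3 - 27 * X * qProd 3 ^ 9, hcube, ?_, ?_, hP2⟩
  · rw [show qProd 1 ^ 9 = (qProd 1 ^ 3) ^ 3 by ring, hP]
    simp only [map_mul, map_neg, map_sub, map_pow, map_ofNat, expand_X]
    ring
  · have hN := cubicNorm_apply hcube
    rw [map_pow] at hN
    -- The class-`2` component of `f₁³` vanishes, so its norm reduces to the cube of `P` plus `X`
    -- times the cube of `-3 f₃³`.
    have h4 : P ^ 3 - 27 * X * qProd 3 ^ 9 = cubicNorm (qProd 1) ^ 3 := by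
      rw [hN, map_neg, h3]
      ring
    rw [h4, ← mul_pow, cubicNorm_qProd_one]
    ring

/-! ### Signs of the coefficients of `f₁ ^ 9 / f₃ ^ i` -/

theorem posCoeff_ninth_power_components {P : ℚ⟦X⟧} (hP : PosCoeff (P * partSeries ^ 2)) {i : ℕ}
    (hi : 9 ≤ i) : PosCoeff (P ^ 2 * qProd 3 ^ 3 * partSeries ^ i) ∧
      PosCoeff (P * qProd 3 ^ 6 * partSeries ^ i) := by
  obtain ⟨k, rfl⟩ := Nat.exists_eq_add_of_le hi
  constructor
  · have h := (hP.mul_pos hP).mul_pos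
      (posCoeff_qProd_three_pow_mul (show 3 ≤ 5 + k by omega) (by omega))
    convert h using 1
    ring
  · have h := hP.mul_pos (posCoeff_qProd_three_pow_mul (show 6 ≤ 7 + k by omega) (by omega))
    convert h using 1
    ring

/-- The classes `1` and `2` behave alike for all `i ≥ 9`. In the class `0` the component `f₁¹² /
f₃³` leaves `f₁^(12-i) / f₃³`; `G` stands for the power of `f₁`, to be supplied in the form suited
to each `i`. -/
theorem sign_ninth_power_quotient {i : ℕ} (hi : 9 ≤ i) {a : ℕ → ℚ}
    (ha : qProd 1 ^ 9 * (qProd 3 ^ i)⁻¹ = PowerSeries.mk a) (n : ℕ) :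
    (n % 3 = 1 → a n < 0) ∧ (n % 3 = 2 → 0 < a n) ∧ ∀ G : ℚ⟦X⟧, qProd 1 ^ 12 * partSeries ^ i = G →
      n % 3 = 0 → a n = coeff (n / 3) (G * expand 3 (by norm_num) (partSeries ^ 3)) := by
  obtain ⟨P, B, -, h9, hB, hP⟩ := ninth_power_dissection
  obtain ⟨hc1, hc2⟩ := posCoeff_ninth_power_components hP hi
  have h1 := quotient_eq_expand (by norm_num) ha n
  rw [h9, coeff_three_dissection_mul] at h1
  rw [h1]
  refine ⟨fun h => ?_, fun h => ?_, fun G hG h => ?_⟩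
  · rw [if_neg (by omega), if_pos h]
    exact coeff_neg_of_posCoeff (by norm_num) hc1 (mul_assoc _ _ _) _
  · rw [if_neg (by omega), if_neg (by omega), mul_assoc, coeff_C_mul]
    exact mul_pos (by norm_num) (hc2 _)
  · rw [if_pos h]
    congr 1
    have h3 := congrArg (· ^ 3) (qProd_mul_expand_partSeries (show 3 ≠ 0 by norm_num))
    simp only [mul_pow, one_pow] at h3
    rw [← hG, map_pow, ← hB]
    linear_combination (-B * partSeries ^ i) * h3

theorem qProd_one_pow_mul_partSeries_pow (k l : ℕ) :
    qProd 1 ^ (k + l) * partSeries ^ l = qProd 1 ^ k := by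
  rw [pow_add, mul_assoc, ← mul_pow, qProd_one_mul_partSeries, one_pow, mul_one]

/-- Here the multiples of `3` carry `f₁³ / f₃³`. The 3-dissection of `f₁³` applies again and refines
the class `0` modulo `3` to the classes `0`, `3`, `6` modulo `9`. -/
theorem sign_ninth_power_quotient_nine {a : ℕ → ℚ}
    (ha : qProd 1 ^ 9 * (qProd 3 ^ 9)⁻¹ = PowerSeries.mk a) (n : ℕ) :
    (n % 9 ∈ ({0, 2, 5, 8} : Set ℕ) → 0 < a n) ∧
      (n % 9 ∈ ({1, 3, 4, 7} : Set ℕ) → a n < 0) ∧ (n % 9 = 6 → a n = 0) := by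
  obtain ⟨hneg, hpos, h0⟩ := sign_ninth_power_quotient le_rfl ha n
  have h0 := h0 _ (qProd_one_pow_mul_partSeries_pow 3 9)
  obtain ⟨P, -, hcube, -, -, hP⟩ := ninth_power_dissection
  rw [hcube, coeff_three_dissection_mul] at h0
  have hp0 : PosCoeff (P * partSeries ^ 3) := by
    have := hP.mul_pos (posCoeff_partSeries_pow one_pos)
    convert this using 1
    ring
  have hmod : n / 3 % 3 = n % 9 / 3 := by omega
  simp only [Set.mem_insert_iff, Set.mem_singleton_iff]
  refine ⟨fun h => ?_, fun h => ?_, fun h => ?_⟩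
  · by_cases h3 : n % 3 = 0
    · rw [h0 h3, if_pos (by omega)]
      exact hp0 _
    · exact hpos (by omega)
  · by_cases h3 : n % 3 = 0
    · rw [h0 h3, if_neg (by omega), if_pos (by omega)]
      exact coeff_neg_of_posCoeff (by norm_num)
        (posCoeff_qProd_three_pow_mul le_rfl (by norm_num)) (mul_assoc _ _ _) _
    · exact hneg (by omega)
  · rw [h0 (by omega), if_neg (by omega), if_neg (by omega), zero_mul, map_zero]

theorem sign_ninth_power_quotient_eleven {a : ℕ → ℚ}
    (ha : qProd 1 ^ 9 * (qProd 3 ^ 11)⁻¹ = PowerSeries.mk a) (n : ℕ) :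
    (n % 9 ∈ ({0, 2, 5, 8} : Set ℕ) → 0 < a n) ∧
      (n % 9 ∈ ({1, 3, 4, 6, 7} : Set ℕ) → a n < 0) := by
  obtain ⟨hneg, hpos, h0⟩ := sign_ninth_power_quotient (by norm_num) ha n
  have h0 := h0 _ (qProd_one_pow_mul_partSeries_pow 1 11)
  have h1 : qProd 1 ^ 1 = expand 3 (by norm_num) (signedTheta 5 4)
      + X * expand 3 (by norm_num) (C (-1) * signedTheta 2 7)
      + X ^ 2 * expand 3 (by norm_num) (C (-1) * signedTheta 8 1) := by
    rw [pow_one]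
    conv_lhs => rw [qProd_one_dissection_three]
    simp only [map_mul, map_neg, map_one]
    ring
  rw [h1, coeff_three_dissection_mul] at h0
  simp only [Set.mem_insert_iff, Set.mem_singleton_iff]
  refine ⟨fun h => ?_, fun h => ?_⟩
  · by_cases h3 : n % 3 = 0
    · rw [h0 h3, if_pos (by omega)]
      exact posCoeff_signedTheta_mul (by norm_num) (by norm_num) (by norm_num) (by norm_num) _
    · exact hpos (by omega)
  · by_cases h3 : n % 3 = 0
    · rw [h0 h3, if_neg (by omega)]
      split_ifs
      · exact coeff_neg_of_posCoeff (by norm_num) (posCoeff_signedTheta_mul (by norm_num)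
          (by norm_num) (by norm_num) (by norm_num)) (mul_assoc _ _ _) _
      · exact coeff_neg_of_posCoeff (by norm_num) (posCoeff_signedTheta_mul (by norm_num)
          (by norm_num) (by norm_num) (by norm_num)) (mul_assoc _ _ _) _
    · exact hneg (by omega)

theorem sign_ninth_power_quotient_twelve {a : ℕ → ℚ}
    (ha : qProd 1 ^ 9 * (qProd 3 ^ 12)⁻¹ = PowerSeries.mk a) (n : ℕ) :
    (n % 9 ∈ ({0, 2, 5, 8} : Set ℕ) → 0 < a n) ∧
      (n % 9 ∈ ({1, 4, 7} : Set ℕ) → a n < 0) ∧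
      (n % 9 ∈ ({3, 6} : Set ℕ) → a n = 0) := by
  obtain ⟨hneg, hpos, h0⟩ := sign_ninth_power_quotient (by norm_num) ha n
  have h0 := h0 _ (qProd_one_pow_mul_partSeries_pow 0 12)
  rw [pow_zero, one_mul, coeff_expand] at h0
  simp only [Set.mem_insert_iff, Set.mem_singleton_iff]
  refine ⟨fun h => ?_, fun h => hneg (by omega), fun h => ?_⟩
  · by_cases h3 : n % 3 = 0
    · rw [h0 h3, if_pos (by omega)]
      exact posCoeff_partSeries_pow (by norm_num) _
    · exact hpos (by omega)
  · rw [h0 (by omega), if_neg (by omega)]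

theorem sign_ninth_power_quotient_gt {i : ℕ} (hi : 12 < i) {a : ℕ → ℚ}
    (ha : qProd 1 ^ 9 * (qProd 3 ^ i)⁻¹ = PowerSeries.mk a) (n : ℕ) :
    (n % 3 ∈ ({0, 2} : Set ℕ) → 0 < a n) ∧ (n % 3 = 1 → a n < 0) := by
  obtain ⟨hneg, hpos, h0⟩ := sign_ninth_power_quotient (by omega) ha n
  obtain ⟨k, rfl⟩ := Nat.exists_eq_add_of_lt hi
  have h1 : qProd 1 ^ 12 * partSeries ^ (12 + k + 1) = partSeries ^ (k + 1) := by
    rw [add_assoc, pow_add, ← mul_assoc, ← mul_pow, qProd_one_mul_partSeries, one_pow, one_mul]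
  have h0 := h0 _ h1
  simp only [Set.mem_insert_iff, Set.mem_singleton_iff]
  refine ⟨fun h => ?_, hneg⟩
  rcases h with h | h
  · rw [h0 h]
    refine (posCoeff_partSeries_pow (Nat.succ_pos k)).mul (fun d => ?_) (by
      rw [constantCoeff_expand]
      exact (posCoeff_partSeries_pow (by norm_num)).constantCoeff_pos) _
    rw [coeff_expand]
    split_ifs
    · exact (posCoeff_partSeries_pow (by norm_num) _).le
    · exact le_rfl
  · exact hpos h

/-! ### The 5-dissection of `f₁ ^ 2` -/

theorem constantCoeff_signedTheta {i j : ℕ} (hi : 0 < i) (hj : 0 < j) :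
    constantCoeff (signedTheta i j) = 1 := by
  rw [signedTheta_eq_eProd hi hj, constantCoeff_eProd]

/-- The component of `f₁` in the residue class of `0` modulo `5`. -/
noncomputable def fiveZero : ℚ⟦X⟧ := signedTheta 8 7 + X * signedTheta 2 13

/-- The negative of the component of `f₁` in the residue class of `2` modulo `5`. -/
noncomputable def fiveTwo : ℚ⟦X⟧ := signedTheta 11 4 - X * signedTheta 14 1

theorem constantCoeff_fiveZero : constantCoeff fiveZero = 1 := by
  simp [fiveZero, constantCoeff_signedTheta]

theorem constantCoeff_fiveTwo : constantCoeff fiveTwo = 1 := by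
  simp [fiveTwo, constantCoeff_signedTheta]

/-- Modulo `5` the product `r (r + 1)` takes only the values `0`, `1`, `2`, never `4`. -/
theorem tri_mod_five_ne_two (r : ℤ) (n : ℕ) : tri r ≠ 5 * n + 2 := by
  intro h
  have h1 := congrArg (Int.cast : ℤ → ZMod 5) (two_mul_tri r)
  rw [h] at h1
  push_cast at h1
  have h5 : (5 : ZMod 5) = 0 := rfl
  have h2 : ∀ x : ZMod 5, x * (x + 1) ≠ 2 * (0 * n + 2) := by
    rw [zero_mul]
    decide
  rw [h5] at h1
  exact h2 _ h1.symm

/-- Jacobi's series for `f₁³` has no exponent congruent to `2` modulo `5`. Cubing the 5-dissection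
of `f₁` gives `3 A (f₅² - A B)` as that component, where `A = fiveZero` and `B = fiveTwo`; since `3
A ≠ 0`, the bracket vanishes. -/
theorem fiveZero_mul_fiveTwo : fiveZero * fiveTwo = qProd 5 ^ 2 := by
  have hq := qProd_one_dissection_five
  rw [← fiveZero, ← fiveTwo] at hq
  have h1 : qProd 1 ^ 3 = ∑ j ∈ Finset.range 5, X ^ j * expand 5 (by norm_num)
      ((fun j : ℕ => if j = 0 then fiveZero ^ 3 - 3 * X * qProd 5 * fiveTwo ^ 2
        else if j = 1 then -3 * fiveZero ^ 2 * qProd 5 - X * fiveTwo ^ 3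
        else if j = 2 then 3 * fiveZero * qProd 5 ^ 2 - 3 * fiveZero ^ 2 * fiveTwo
        else if j = 3 then 6 * fiveZero * qProd 5 * fiveTwo - qProd 5 ^ 3
        else 3 * fiveZero * fiveTwo ^ 2 - 3 * qProd 5 ^ 2 * fiveTwo) j) := by
    rw [hq]
    simp only [Finset.sum_range_succ, Finset.sum_range_zero]
    simp only [if_true, if_false, one_ne_zero, OfNat.ofNat_ne_zero, OfNat.ofNat_ne_one,
      Nat.reduceEqDiff, map_sub, map_mul, map_pow, map_neg, map_ofNat,
      expand_X]
    ring
  have h2 : dissect 5 2 (qProd 1 ^ 3)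
      = 3 * fiveZero * qProd 5 ^ 2 - 3 * fiveZero ^ 2 * fiveTwo := by
    rw [h1]
    exact dissect_sum _ _ (by norm_num)
  have h3 : dissect 5 2 (qProd 1 ^ 3) = 0 := by
    ext n
    rw [dissect, coeff_mk, map_zero]
    exact coeff_theta_eq_zero hasSum_qProd_one_cube fun r => tri_mod_five_ne_two r n
  have h4 : 3 * fiveZero * (qProd 5 ^ 2 - fiveZero * fiveTwo) = 0 := by
    rw [← h3, h2]
    ring
  have h5 : fiveZero ≠ 0 := fun h => by
    have := constantCoeff_fiveZero
    rw [h, map_zero] at this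
    exact zero_ne_one this
  have h6 : (3 : ℚ⟦X⟧) ≠ 0 := fun h => by
    have := congrArg constantCoeff h
    simp [map_ofNat] at this
  have h7 := (mul_eq_zero.mp h4).resolve_left (mul_ne_zero h6 h5)
  exact (sub_eq_zero.mp h7).symm

theorem nonnegCoeff_fiveZero_mul : NonnegCoeff (fiveZero * partSeries) := by
  rw [fiveZero, add_mul, mul_assoc]
  refine (nonnegCoeff_signedTheta_mul (by norm_num) (by norm_num) (by norm_num)).add ?_
  have := nonnegCoeff_X_pow 1
  rw [pow_one] at this
  exact this.mul (nonnegCoeff_signedTheta_mul (by norm_num) (by norm_num) (by norm_num))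

/-! ### Nonnegativity of `fiveTwo * partSeries` -/

theorem X_pow_dvd_eInv_sub_one {c : ℕ → ℕ} {N : ℕ} (hc : ∀ n < N, c n = 0) :
    X ^ N ∣ eInv c - 1 := by
  have h := (X_pow_dvd_eProd_sub_one hc).mul_right (-eInv c)
  convert h using 1
  linear_combination eProd_mul_eInv_self c

/-- Factors of index at least `N > d` do not affect the coefficient at `d`, so a claim about the
infinite product follows from truncations, which allow induction. -/
theorem coeff_mul_eInv_truncate (W : ℚ⟦X⟧) (c : ℕ → ℕ) {d N : ℕ} (hd : d < N) :
    coeff d (W * eInv c) = coeff d (W * eInv (fun n => if n < N then c n else 0)) := by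
  have h : eInv c = eInv (fun n => if n < N then c n else 0)
      * eInv (fun n => if n < N then 0 else c n) := by
    rw [← eInv_add]
    refine eInv_congr fun n _ => ?_
    split_ifs <;> simp
  rw [h, ← mul_assoc]
  exact coeff_mul_of_X_pow_dvd hd (X_pow_dvd_eInv_sub_one fun n hn => if_pos hn)

/-- Exponents of the residue classes `±i` modulo `15`. -/
def modFifteen (i n : ℕ) : ℕ := if n % 15 = i ∨ n % 15 = 15 - i then 1 else 0

/-- Exponents of the residue classes modulo `15` other than `0`, `±1`, `±4`. -/
def modFifteenCompl (n : ℕ) : ℕ :=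
  if n % 15 = 0 ∨ n % 15 = 1 ∨ n % 15 = 14 ∨ n % 15 = 4 ∨ n % 15 = 11 then 0 else 1

theorem eInv_modFifteen_succ {i : ℕ} (hi : 0 < i) (hi' : i < 8) (m : ℕ) :
    eInv (fun n => if n < 15 * (m + 1) then modFifteen i n else 0)
      = eInv (fun n => if n < 15 * m then modFifteen i n else 0)
        * ((1 - X ^ (15 * m + i))⁻¹ * (1 - X ^ (15 * m + (15 - i)))⁻¹) := by
  rw [← eInv_single _ (by omega), ← eInv_single _ (by omega), ← eInv_add, ← eInv_add]
  refine eInv_congr fun n _ => ?_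
  simp only [modFifteen]
  split_ifs <;> omega

/-- Both pairs of exponents have the sum `30 m + 15`, so the difference of the denominators is `X ^
(15 m + 1) (1 - X³ - X¹⁰ + X¹³)`, which factors. -/
theorem inv_mul_inv_sub_inv_mul_inv (m : ℕ) :
    (1 - X ^ (15 * m + 1) : ℚ⟦X⟧)⁻¹ * (1 - X ^ (15 * m + 14))⁻¹
        - (1 - X ^ (15 * m + 4))⁻¹ * (1 - X ^ (15 * m + 11))⁻¹
      = (1 - X ^ 3) * (1 - X ^ 10) * (X ^ (15 * m + 1) *
        ((1 - X ^ (15 * m + 1))⁻¹ * (1 - X ^ (15 * m + 14))⁻¹)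
        * ((1 - X ^ (15 * m + 4))⁻¹ * (1 - X ^ (15 * m + 11))⁻¹)) := by
  have h1 := one_sub_X_pow_mul_inv (show 0 < 15 * m + 1 by omega)
  have h2 := one_sub_X_pow_mul_inv (show 0 < 15 * m + 14 by omega)
  have h3 := one_sub_X_pow_mul_inv (show 0 < 15 * m + 4 by omega)
  have h4 := one_sub_X_pow_mul_inv (show 0 < 15 * m + 11 by omega)
  generalize (1 - X ^ (15 * m + 1) : ℚ⟦X⟧)⁻¹ = a at *
  generalize (1 - X ^ (15 * m + 14) : ℚ⟦X⟧)⁻¹ = b at *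
  generalize (1 - X ^ (15 * m + 4) : ℚ⟦X⟧)⁻¹ = u at *
  generalize (1 - X ^ (15 * m + 11) : ℚ⟦X⟧)⁻¹ = v at *
  have hab : (1 - X ^ (15 * m + 1)) * (1 - X ^ (15 * m + 14)) * (a * b) = 1 := by
    linear_combination (1 - X ^ (15 * m + 14)) * b * h1 + h2
  have huv : (1 - X ^ (15 * m + 4)) * (1 - X ^ (15 * m + 11)) * (u * v) = 1 := by
    linear_combination (1 - X ^ (15 * m + 11)) * v * h3 + h4
  linear_combination (u * v) * hab - (a * b) * huv

/-- If `P`, `Q` are the two truncated products and `a`, `b` their next factors, then `P a - Q b = (P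
- Q) a + Q (a - b)`. The negative signs in `a - b` come from `(1 - X³) (1 - X¹⁰)`, which `eInv
modFifteenCompl` cancels, as `3` and `10` lie in its classes. -/
theorem nonnegCoeff_modFifteen_truncated (m : ℕ) :
    NonnegCoeff (eInv modFifteenCompl * (eInv (fun n => if n < 15 * m then modFifteen 1 n else 0)
      - eInv (fun n => if n < 15 * m then modFifteen 4 n else 0))) := by
  induction m with
  | zero =>
    simp only [mul_zero, Nat.not_lt_zero, if_false, sub_self]
    exact fun n => by simp
  | succ m ih =>
    have hC : eInv modFifteenCompl
        = eInv (fun n => if n = 3 ∨ n = 10 then 0 else modFifteenCompl n)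
          * ((1 - X ^ 3)⁻¹ * (1 - X ^ 10)⁻¹) := by
      rw [← eInv_single _ (by norm_num), ← eInv_single _ (by norm_num), ← eInv_add, ← eInv_add]
      refine eInv_congr fun n _ => ?_
      simp only [modFifteenCompl]
      split_ifs <;> omega
    rw [eInv_modFifteen_succ one_pos (by norm_num), eInv_modFifteen_succ four_pos (by norm_num)]
    have hab := inv_mul_inv_sub_inv_mul_inv m
    have n1 := nonnegCoeff_one_sub_X_pow_inv (show 0 < 15 * m + 1 by omega)
    have n2 := nonnegCoeff_one_sub_X_pow_inv (show 0 < 15 * m + 14 by omega)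
    have n3 := nonnegCoeff_one_sub_X_pow_inv (show 0 < 15 * m + 4 by omega)
    have n4 := nonnegCoeff_one_sub_X_pow_inv (show 0 < 15 * m + 11 by omega)
    have key := (ih.mul (n1.mul n2)).add
      ((nonnegCoeff_eInv (fun n => if n < 15 * m then modFifteen 4 n else 0)).mul
        ((nonnegCoeff_eInv (fun n => if n = 3 ∨ n = 10 then 0 else modFifteenCompl n)).mul
          (((nonnegCoeff_X_pow (15 * m + 1)).mul (n1.mul n2)).mul (n3.mul n4))))
    convert key using 1
    have h3 := one_sub_X_pow_mul_inv (show 0 < 3 by norm_num)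
    have h10 := one_sub_X_pow_mul_inv (show 0 < 10 by norm_num)
    norm_num only [show 15 - 1 = 14 from rfl, show 15 - 4 = 11 from rfl]
    generalize (1 - X ^ (15 * m + 1) : ℚ⟦X⟧)⁻¹ * (1 - X ^ (15 * m + 14))⁻¹ = a at *
    generalize (1 - X ^ (15 * m + 4) : ℚ⟦X⟧)⁻¹ * (1 - X ^ (15 * m + 11))⁻¹ = b at *
    generalize eInv (fun n => if n < 15 * m then modFifteen 1 n else 0) = P at *
    generalize eInv (fun n => if n < 15 * m then modFifteen 4 n else 0) = Q at *
    generalize eInv (fun n => if n = 3 ∨ n = 10 then 0 else modFifteenCompl n) = D at *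
    have h : eInv modFifteenCompl * (a - b) = D * (X ^ (15 * m + 1) * a * b) := by
      rw [hC, hab]
      linear_combination D * (X ^ (15 * m + 1) * a * b) *
        ((1 - X ^ 10) * (1 - X ^ 10)⁻¹ * h3 + h10)
    linear_combination Q * h

theorem nonnegCoeff_modFifteen :
    NonnegCoeff (eInv modFifteenCompl * (eInv (modFifteen 1) - eInv (modFifteen 4))) := by
  intro d
  have hd : d < 15 * (d + 1) := by omega
  have h := nonnegCoeff_modFifteen_truncated (d + 1) d
  rwa [mul_sub, map_sub, ← coeff_mul_eInv_truncate _ _ hd, ← coeff_mul_eInv_truncate _ _ hd,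
    ← map_sub, ← mul_sub] at h

/-- With `E₁`, `E₄` the inverse products over the classes `±1`, `±4` modulo `15`, the series is a
nonnegative common factor times `E₁ - X E₄ = (1 - X) E₁ + X (E₁ - E₄)`. In the first term `1 - X`
cancels a factor of `E₁`; the second is `nonnegCoeff_modFifteen`. -/
theorem nonnegCoeff_fiveTwo_mul : NonnegCoeff (fiveTwo * partSeries) := by
  have h1 : signedTheta 11 4 * partSeries = eInv modFifteenCompl * eInv (modFifteen 1) := by
    rw [signedTheta_eq_eProd (by norm_num) (by norm_num), partSeries, ← eInv_add]
    refine eProd_mul_eInv fun n _ => ?_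
    simp only [modFifteen, modFifteenCompl]
    split_ifs <;> omega
  have h2 : signedTheta 14 1 * partSeries = eInv modFifteenCompl * eInv (modFifteen 4) := by
    rw [signedTheta_eq_eProd (by norm_num) (by norm_num), partSeries, ← eInv_add]
    refine eProd_mul_eInv fun n _ => ?_
    simp only [modFifteen, modFifteenCompl]
    split_ifs <;> omega
  have h3 : NonnegCoeff ((1 - X ^ 1) * eInv (modFifteen 1)) := by
    rw [← eProd_single 1 one_pos]
    refine nonnegCoeff_eProd_mul_eInv fun n _ => ?_
    simp only [modFifteen]
    split_ifs <;> omega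
  have key := ((nonnegCoeff_eInv modFifteenCompl).mul h3).add
    ((nonnegCoeff_X_pow 1).mul nonnegCoeff_modFifteen)
  convert key using 1
  rw [fiveTwo]
  linear_combination h1 - X * h2

theorem posCoeff_qProd_five_mul : PosCoeff (qProd 5 * partSeries) := by
  rw [qProd_eq_eProd (by norm_num), partSeries]
  refine posCoeff_eProd_mul_eInv (fun n _ => ?_) (by norm_num)
  split_ifs <;> omega

/-- Of the three powers of `partSeries`, each factor absorbs one; the third makes all coefficients
strictly positive. -/
theorem posCoeff_mul_mul_partSeries {F G : ℚ⟦X⟧} (hF : NonnegCoeff (F * partSeries))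
    (hG : NonnegCoeff (G * partSeries)) (hF0 : constantCoeff F = 1) (hG0 : constantCoeff G = 1) :
    PosCoeff (F * G * partSeries ^ 3) := by
  have hc : constantCoeff partSeries = 1 := constantCoeff_eInv _
  have := (posCoeff_partSeries_pow one_pos).mul (hF.mul hG) (by
    simp only [map_mul, hF0, hG0, hc]
    norm_num)
  convert this using 1
  ring

theorem sign_square_quotient_five {a : ℕ → ℚ}
    (ha : qProd 1 ^ 2 * (qProd 5 ^ 3)⁻¹ = PowerSeries.mk a) (n : ℕ) :
    (n % 5 ∈ ({0, 3, 4} : Set ℕ) → 0 < a n) ∧ (n % 5 ∈ ({1, 2} : Set ℕ) → a n < 0) := by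
  have h1 := quotient_eq_expand (by norm_num) ha n
  have h2 : qProd 1 ^ 2 = ∑ j ∈ Finset.range 5, X ^ j * expand 5 (by norm_num)
      ((fun j : ℕ => if j = 0 then C 1 * (fiveZero * fiveZero)
        else if j = 1 then C (-2) * (fiveZero * qProd 5)
        else if j = 2 then C (-1) * (qProd 5 * qProd 5)
        else if j = 3 then C 2 * (qProd 5 * fiveTwo)
        else C 1 * (fiveTwo * fiveTwo)) j) := by
    have hq := qProd_one_dissection_five
    rw [← fiveZero, ← fiveTwo] at hq
    have h3 := congrArg (expand 5 (by norm_num)) fiveZero_mul_fiveTwo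
    rw [hq]
    simp only [Finset.sum_range_succ, Finset.sum_range_zero]
    simp only [if_true, if_false, one_ne_zero, OfNat.ofNat_ne_zero, OfNat.ofNat_ne_one,
      Nat.reduceEqDiff, map_mul, map_pow, map_neg, map_ofNat, map_one] at h3 ⊢
    -- In the class `2` the square gives `f₅² - 2 A B`, which is `-f₅²` because `A B = f₅²`.
    linear_combination (-2) * X ^ 2 * h3
  rw [h2, coeff_dissection_mul] at h1
  have c0 := constantCoeff_fiveZero
  have c2 := constantCoeff_fiveTwo
  have c5 : constantCoeff (qProd 5) = 1 := constantCoeff_qProd (by norm_num)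
  have n0 := nonnegCoeff_fiveZero_mul
  have n2 := nonnegCoeff_fiveTwo_mul
  have n5 := posCoeff_qProd_five_mul.nonneg
  rw [h1]
  simp only [Set.mem_insert_iff, Set.mem_singleton_iff]
  constructor
  · rintro (h | h | h) <;> simp only [h, if_true, if_false, OfNat.ofNat_ne_zero,
      OfNat.ofNat_ne_one, Nat.reduceEqDiff] <;>
      rw [mul_assoc, coeff_C_mul]
    · exact mul_pos (by norm_num) (posCoeff_mul_mul_partSeries n0 n0 c0 c0 _)
    · exact mul_pos (by norm_num) (posCoeff_mul_mul_partSeries n5 n2 c5 c2 _)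
    · exact mul_pos (by norm_num) (posCoeff_mul_mul_partSeries n2 n2 c2 c2 _)
  · rintro (h | h) <;> simp only [h, if_true, if_false, one_ne_zero, OfNat.ofNat_ne_zero,
      OfNat.ofNat_ne_one, Nat.reduceEqDiff]
    · exact coeff_neg_of_posCoeff (by norm_num) (posCoeff_mul_mul_partSeries n0 n5 c0 c5)
        (mul_assoc _ _ _) _
    · exact coeff_neg_of_posCoeff (by norm_num) (posCoeff_mul_mul_partSeries n5 n5 c5 c5)
        (mul_assoc _ _ _) _

end EtaSigns

theorem theorem1p3 :
    (∀ p : ℕ, p.Prime → 3 ≤ p → ∀ a : ℕ → ℚ,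
      qProd 2 ^ 2 * (qProd 1 * qProd p)⁻¹ = PowerSeries.mk a →
      ∀ n : ℕ, signBound (fun r => r * (r + 1) / 2) p < (n : ℤ) →
        ((∃ r < p, n ≡ r * (r + 1) / 2 [MOD p]) → 0 < a n) ∧
        ((¬ ∃ r < p, n ≡ r * (r + 1) / 2 [MOD p]) → a n = 0)) ∧
    (∀ p : ℕ, (p = 1 ∨ (p.Prime ∧ Odd p)) → ∀ a : ℕ → ℚ,
      qProd 1 ^ 2 * (qProd 2 * qProd (4 * p))⁻¹ = PowerSeries.mk a →
      ∀ n : ℕ, signBound (fun r => r ^ 2) (4 * p) < (n : ℤ) →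
        ((∃ t < p, n ≡ 4 * t ^ 2 + 4 * t + 1 [MOD 4 * p]) → a n < 0) ∧
        ((∃ t < p, n ≡ 4 * t ^ 2 [MOD 4 * p]) → 0 < a n) ∧
        (((¬ ∃ t < p, n ≡ 4 * t ^ 2 + 4 * t + 1 [MOD 4 * p]) ∧
          (¬ ∃ t < p, n ≡ 4 * t ^ 2 [MOD 4 * p])) → a n = 0) ∧
        (((¬ ∃ t < p, n ≡ 4 * t ^ 2 + 4 * t + 1 [MOD 4 * p]) ∧
          (¬ ∃ t < p, n ≡ 4 * t ^ 2 [MOD 4 * p])) ↔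
            (n % 4 = 2 ∨ n % 4 = 3 ∨ jacobiSym (n : ℤ) p = -1))) ∧
    (∀ a : ℕ → ℚ, qProd 1 ^ 3 * (qProd 3 ^ 2)⁻¹ = PowerSeries.mk a → ∀ n : ℕ,
      (n % 3 = 0 → 0 < a n) ∧ (n % 3 = 1 → a n < 0) ∧ (n % 3 = 2 → a n = 0)) ∧
    (∀ a : ℕ → ℚ, qProd 1 ^ 2 * (qProd 2 * qProd 3 ^ 2)⁻¹ = PowerSeries.mk a → ∀ n : ℕ,
      (n % 3 = 0 → 0 < a n) ∧ (n % 3 = 1 → a n < 0) ∧ (n % 3 = 2 → a n = 0)) ∧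
    (∀ a : ℕ → ℚ, qProd 1 ^ 4 * (qProd 2 ^ 2 * qProd 4)⁻¹ = PowerSeries.mk a → ∀ n : ℕ,
      (n % 4 ∈ ({0, 2} : Set ℕ) → 0 < a n) ∧ (n % 4 = 1 → a n < 0) ∧ (n % 4 = 3 → a n = 0)) ∧
    (∀ a : ℕ → ℚ, qProd 2 ^ 10 * (qProd 1 ^ 4 * qProd 4 ^ 5)⁻¹ = PowerSeries.mk a → ∀ n : ℕ,
      (n % 4 ∈ ({0, 1, 2} : Set ℕ) → 0 < a n) ∧ (n % 4 = 3 → a n = 0)) ∧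
    (∀ a : ℕ → ℚ, qProd 1 ^ 2 * (qProd 5 ^ 3)⁻¹ = PowerSeries.mk a → ∀ n : ℕ,
      (n % 5 ∈ ({0, 3, 4} : Set ℕ) → 0 < a n) ∧ (n % 5 ∈ ({1, 2} : Set ℕ) → a n < 0)) ∧
    (∀ a : ℕ → ℚ, qProd 1 ^ 9 * (qProd 3 ^ 9)⁻¹ = PowerSeries.mk a → ∀ n : ℕ,
      (n % 9 ∈ ({0, 2, 5, 8} : Set ℕ) → 0 < a n) ∧
      (n % 9 ∈ ({1, 3, 4, 7} : Set ℕ) → a n < 0) ∧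
      (n % 9 = 6 → a n = 0)) ∧
    (∀ i : ℕ, 11 ≤ i → ∀ a : ℕ → ℚ, qProd 1 ^ 9 * (qProd 3 ^ i)⁻¹ = PowerSeries.mk a →
      (i = 11 → ∀ n : ℕ,
        (n % 9 ∈ ({0, 2, 5, 8} : Set ℕ) → 0 < a n) ∧
        (n % 9 ∈ ({1, 3, 4, 6, 7} : Set ℕ) → a n < 0)) ∧
      (i = 12 → ∀ n : ℕ,
        (n % 9 ∈ ({0, 2, 5, 8} : Set ℕ) → 0 < a n) ∧
        (n % 9 ∈ ({1, 4, 7} : Set ℕ) → a n < 0) ∧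
        (n % 9 ∈ ({3, 6} : Set ℕ) → a n = 0)) ∧
      (12 < i → ∀ n : ℕ,
        (n % 3 ∈ ({0, 2} : Set ℕ) → 0 < a n) ∧ (n % 3 = 1 → a n < 0))) := by
  refine ⟨fun p hp h3 a ha n hn => ?_, fun p hp a ha n hn => ?_, fun a ha n => ?_,
    fun a ha n => ?_, fun a ha n => ?_, fun a ha n => ?_, fun a ha n => ?_, fun a ha n => ?_,
    fun i _ a ha => ⟨fun hi n => ?_, fun hi n => ?_, fun hi n => ?_⟩⟩
  · exact sign_triangular_quotient (hp.odd_of_ne_two (by lia)) ha hn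
  · exact sign_square_quotient hp ha hn
  · exact sign_cube_quotient ha n
  · exact sign_signedTheta_quotient ha n
  · exact sign_signedTheta_sq_quotient ha n
  · exact sign_squareTheta_sq_quotient ha n
  · exact sign_square_quotient_five ha n
  · exact sign_ninth_power_quotient_nine ha n
  · subst hi
    exact sign_ninth_power_quotient_eleven ha n
  · subst hi
    exact sign_ninth_power_quotient_twelve ha n
  · exact sign_ninth_power_quotient_gt hi ha n
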